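/- Let $N\ge 2$ and $D>1$ be integers, and let $A$ be an $N\times N$ matrix with entries in $\{0,1\}$, rows and columns indexed by $\mathbb Z_N=\{0,\dots,N-1\}$, having exactly $D$ entries equal to $1$, in the positions $(a_0,b_0)<(a_1,b_1)<\dots<(a_{D-1},b_{D-1})$ (lexicographic order). Let $$\mathbb S_A=\Bigl\{\Bigl(\sum_{i\ge1}\frac{x_i}{N^i},\ \sum_{i\ge1}\frac{y_i}{N^i}\Bigr):\ x_i,y_i\in\mathbb Z_N,\ A_{x_i,y_i}=1\ \text{for all } i\ge 1\Bigr\}\subset[0,1]^2,$$ and let $H$ be the Hausdorff measure of dimension $\ln D/\ln N$ on $\mathbb S_A$, normalized to total mass $1$. For $j\in\mathbb Z_D$ let $\tau_j:\mathbb S_A\to\mathbb S_A$ be $\tau_j(x,y)=\bigl(\frac{x+a_j}{N},\frac{y+b_j}{N}\bigr)$, and let $\tau:\mathbb S_A\to\mathbb S_A$ be $\tau(x,y)=\bigl(N(x-\frac{x_1}{N}),N(y-\frac{y_1}{N})\bigr)$, where $x_1,y_1$ are the first digits of an expansion of $(x,y)$ as above (for points with several such expansions any choice is allowed). Let $\mathcal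 O_D$ be the Cuntz algebra, the universal unital $C^*$-algebra generated by $s_0,\dots,s_{D-1}$ with $s_j^*s_i=\delta_{ij}1$ and $\sum_i s_is_i^*=1$. Let $K_D=\prod_{n\ge 1}\mathbb Z_D$, let $\nu_D$ be the product of the uniform probability measures on $\mathbb Z_D$, let $\sigma_i(i_1i_2\cdots)=(i\,i_1i_2\cdots)$ and $\sigma(i_1i_2\cdots)=(i_2i_3\cdots)$ on $K_D$, and let $f_i=\sqrt D\,\chi_{\sigma_i(K_D)}$. Then: 1. $H$ is a probability measure, and $(\tau_j)_{j\in\mathbb Z_D}$ is a semibranching function system on $(\mathbb S_A,H)$ with coding map $\tau$: the maps $\tau_j$ are measurable; the sets $\tau_j(\mathbb S_A)$ cover $\mathbb S_A$ up to an $H$-null set and have pairwise $H$-null intersections; $H\circ\tau_j\ll H$ with $\frac{d(H\circ\tau_j)}{dH}>0$ $H$-a.e.; and $\tau\circ\tau_j(p)=p$ for $H$-a.e. $p$. There is a unique unital $*$-representation $\pi$ of $\mathcal O_D$ on $L^2(\mathbb S_A,H)$ with $$\pi(s_j)\xi\,(p)=\chi_{\tau_j(\mathbb S_A)}(p)\,\Bigl(\frac{d(H\circ\tau_j)}{dH}(\tau(p))\Bigr)^{-1/2}\xi(\tau(p))\qquad(j\in\mathbb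 Z_D,\ \xi\in L^2(\mathbb S_A,H)).$$ 2. $(\nu_D,(f_i)_{i\in\mathbb Z_D})$ is a nonnegative monic system (the standard positive monic system): $\nu_D$ is a Borel probability measure, the $f_i$ are nonnegative Borel functions in $L^2(K_D,\nu_D)$, $\nu_D\circ\sigma_i^{-1}\ll\nu_D$ with $\frac{d(\nu_D\circ\sigma_i^{-1})}{d\nu_D}=f_i^2$, and $f_i\ne0$ $\nu_D$-a.e. on $\sigma_i(K_D)$. There is a unique unital $*$-representation $\rho$ of $\mathcal O_D$ on $L^2(K_D,\nu_D)$ (the Dutkay–Jorgensen representation) with $\rho(s_i)f=f_i\,(f\circ\sigma)$ for $i\in\mathbb Z_D$, $f\in L^2(K_D,\nu_D)$. 3. The representations $\pi$ and $\rho$ are unitarily equivalent: there is a unitary $U:L^2(\mathbb S_A,H)\to L^2(K_D,\nu_D)$ with $U\,\pi(a)=\rho(a)\,U$ for all $a\in\mathcal O_D$. -/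

import Mathlib

open MeasureTheory

noncomputable section

/-! ### The Cuntz algebra -/

/-- A Cuntz family: `tⱼ* tᵢ = δᵢⱼ 1` and `∑ᵢ tᵢ tᵢ* = 1`. -/
structure IsCuntzFamily {B : Type*} [Ring B] [Star B] {D : ℕ} (t : Fin D → B) : Prop where
  star_mul_eq : ∀ i j, star (t j) * t i = if i = j then 1 else 0
  sum_mul_star : ∑ i, t i * star (t i) = 1

/-- The free unital complex `*`-algebra on `D` generators: `(i, false)` stands for the `i`-th
generator and `(i, true)` for its adjoint. -/
def CuntzFree (D : ℕ) : Type := FreeAlgebra ℂ (Fin D × Bool)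

namespace CuntzFree

variable {D : ℕ}

instance : Ring (CuntzFree D) := inferInstanceAs (Ring (FreeAlgebra ℂ (Fin D × Bool)))

instance : Algebra ℂ (CuntzFree D) :=
  inferInstanceAs (Algebra ℂ (FreeAlgebra ℂ (Fin D × Bool)))

def gen (x : Fin D × Bool) : CuntzFree D := FreeAlgebra.ι ℂ x

theorem induct {motive : CuntzFree D → Prop}
    (scalar : ∀ r : ℂ, motive (algebraMap ℂ (CuntzFree D) r)) (gens : ∀ x, motive (gen x))
    (mul : ∀ a b, motive a → motive b → motive (a * b))
    (add : ∀ a b, motive a → motive b → motive (a + b)) (a : CuntzFree D) : motive a :=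
  FreeAlgebra.induction ℂ (Fin D × Bool) scalar gens mul add a

/-- The algebra homomorphism out of the free algebra with prescribed values on the letters. -/
def liftFun {B : Type*} [Ring B] [Algebra ℂ B] (f : Fin D × Bool → B) : CuntzFree D →ₐ[ℂ] B :=
  FreeAlgebra.lift ℂ f

theorem liftFun_gen {B : Type*} [Ring B] [Algebra ℂ B] (f : Fin D × Bool → B)
    (x : Fin D × Bool) : liftFun f (gen x) = f x :=
  FreeAlgebra.lift_ι_apply f x

/-- The opposite ring of the free algebra, with the conjugate scalar multiplication. -/
def ConjOp (D : ℕ) : Type := (CuntzFree D)ᵐᵒᵖ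

instance : Ring (ConjOp D) := inferInstanceAs (Ring (CuntzFree D)ᵐᵒᵖ)

instance : Algebra ℂ (ConjOp D) :=
  (Algebra.compHom (CuntzFree D)ᵐᵒᵖ (starRingEnd ℂ) : Algebra ℂ (CuntzFree D)ᵐᵒᵖ)

/-- The involution (conjugate-linear, antimultiplicative, exchanging the letters `(i, false)` and
`(i, true)`), as a homomorphism into the conjugate opposite algebra. -/
def starHom (D : ℕ) : CuntzFree D →ₐ[ℂ] ConjOp D :=
  liftFun fun x => (MulOpposite.op (gen (x.1, !x.2)) : (CuntzFree D)ᵐᵒᵖ)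

instance : Star (CuntzFree D) where
  star a := MulOpposite.unop (show (CuntzFree D)ᵐᵒᵖ from starHom D a)

theorem star_gen (x : Fin D × Bool) : star (gen x) = gen (x.1, !x.2) :=
  congrArg MulOpposite.unop (liftFun_gen (B := ConjOp D) _ x)

theorem star_algebraMap' (r : ℂ) :
    star (algebraMap ℂ (CuntzFree D) r) = algebraMap ℂ (CuntzFree D) (starRingEnd ℂ r) :=
  congrArg MulOpposite.unop ((starHom D).commutes r)

theorem star_mul' (a b : CuntzFree D) : star (a * b) = star b * star a :=
  congrArg MulOpposite.unop (map_mul (starHom D) a b)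

theorem star_add' (a b : CuntzFree D) : star (a + b) = star a + star b :=
  congrArg MulOpposite.unop (map_add (starHom D) a b)

instance : StarRing (CuntzFree D) where
  star_involutive a := by
    induction a using induct with
    | scalar r => rw [star_algebraMap', star_algebraMap', Complex.conj_conj]
    | gens x => simp only [star_gen, Bool.not_not]
    | mul a b ha hb => rw [star_mul', star_mul', ha, hb]
    | add a b ha hb => rw [star_add', star_add', ha, hb]
  star_mul := star_mul'
  star_add := star_add'

instance : StarModule ℂ (CuntzFree D) where
  star_smul r a := by
    rw [Algebra.smul_def, star_mul, star_algebraMap', ← Algebra.commutes, ← Algebra.smul_def]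
    rfl

/-- Evaluation of a `*`-polynomial at elements `t₀, …, t_{D-1}` of a `*`-algebra. -/
def eval {B : Type*} [CStarAlgebra B] (t : Fin D → B) : CuntzFree D →⋆ₐ[ℂ] B where
  toAlgHom := liftFun fun x => if x.2 then star (t x.1) else t x.1
  map_star' a := by
    simp only [AlgHom.toRingHom_eq_coe, RingHom.toMonoidHom_eq_coe, OneHom.toFun_eq_coe,
      MonoidHom.toOneHom_coe, MonoidHom.coe_coe, RingHom.coe_coe]
    induction a using induct with
    | scalar r =>
      rw [star_algebraMap', AlgHom.commutes, AlgHom.commutes, ← algebraMap_star_comm]; rfl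
    | gens x =>
      rw [star_gen, liftFun_gen, liftFun_gen]
      rcases x with ⟨i, _ | _⟩ <;> simp
    | mul a b ha hb => rw [star_mul, map_mul, map_mul, ha, hb, star_mul]
    | add a b ha hb => rw [star_add, map_add, map_add, ha, hb, star_add]

theorem eval_gen {B : Type*} [CStarAlgebra B] (t : Fin D → B) (x : Fin D × Bool) :
    eval t (gen x) = if x.2 then star (t x.1) else t x.1 :=
  liftFun_gen _ x

/-- The values `‖a(t)‖`, for `t` a Cuntz family in some unital C*-algebra. -/
def normSet (a : CuntzFree D) : Set ℝ :=
  {r | ∃ (B : Type) (_ : CStarAlgebra B) (t : Fin D → B), IsCuntzFamily t ∧ r = ‖eval t a‖}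

/-- The universal C*-seminorm: the supremum of `‖a(t)‖` over all Cuntz families `t`. -/
def seminorm (a : CuntzFree D) : ℝ := sSup (normSet a)

theorem norm_one_le' (B : Type*) [CStarAlgebra B] : ‖(1 : B)‖ ≤ 1 := by
  have h := CStarRing.norm_star_mul_self (x := (1 : B))
  rw [star_one, one_mul] at h
  nlinarith [norm_nonneg (1 : B)]

theorem norm_le_one_of_isCuntzFamily {B : Type*} [CStarAlgebra B] {t : Fin D → B}
    (ht : IsCuntzFamily t) (i : Fin D) : ‖t i‖ ≤ 1 := by
  have h := CStarRing.norm_star_mul_self (x := t i)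
  rw [ht.star_mul_eq, if_pos rfl] at h
  nlinarith [norm_nonneg (t i), norm_one_le' B]

theorem exists_bound (a : CuntzFree D) : ∃ C : ℝ, ∀ (B : Type) (_ : CStarAlgebra B)
    (t : Fin D → B), IsCuntzFamily t → ‖eval t a‖ ≤ C := by
  induction a using induct with
  | scalar r =>
    refine ⟨‖r‖, fun B _ t ht => ?_⟩
    rw [AlgHomClass.commutes, Algebra.algebraMap_eq_smul_one, norm_smul]
    nlinarith [norm_nonneg r, norm_one_le' B]
  | gens x =>
    refine ⟨1, fun B _ t ht => ?_⟩
    rw [eval_gen]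
    split_ifs
    · rw [norm_star]; exact norm_le_one_of_isCuntzFamily ht _
    · exact norm_le_one_of_isCuntzFamily ht _
  | mul a b ha hb =>
    obtain ⟨C, hC⟩ := ha
    obtain ⟨C', hC'⟩ := hb
    refine ⟨C * C', fun B _ t ht => ?_⟩
    rw [map_mul]
    exact (norm_mul_le _ _).trans (mul_le_mul (hC B _ t ht) (hC' B _ t ht) (norm_nonneg _)
      ((norm_nonneg _).trans (hC B _ t ht)))
  | add a b ha hb =>
    obtain ⟨C, hC⟩ := ha
    obtain ⟨C', hC'⟩ := hb
    refine ⟨C + C', fun B _ t ht => ?_⟩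
    rw [map_add]
    exact (norm_add_le _ _).trans (add_le_add (hC B _ t ht) (hC' B _ t ht))

theorem norm_eval_le_seminorm {B : Type} [CStarAlgebra B] {t : Fin D → B}
    (ht : IsCuntzFamily t) (a : CuntzFree D) : ‖eval t a‖ ≤ seminorm a := by
  refine le_csSup ?_ ⟨B, _, t, ht, rfl⟩
  obtain ⟨C, hC⟩ := exists_bound a
  refine ⟨C, ?_⟩
  rintro _ ⟨B, _, t, ht, rfl⟩
  exact hC B _ t ht

theorem seminorm_le {a : CuntzFree D} {C : ℝ} (hC : 0 ≤ C)
    (h : ∀ (B : Type) (_ : CStarAlgebra B) (t : Fin D → B), IsCuntzFamily t → ‖eval t a‖ ≤ C) :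
    seminorm a ≤ C := by
  refine Real.sSup_le ?_ hC
  rintro _ ⟨B, _, t, ht, rfl⟩
  exact h B _ t ht

theorem seminorm_nonneg (a : CuntzFree D) : 0 ≤ seminorm a := by
  refine Real.sSup_nonneg ?_
  rintro _ ⟨B, _, t, ht, rfl⟩
  exact norm_nonneg _

theorem seminorm_eq_zero {a : CuntzFree D}
    (h : ∀ (B : Type) (_ : CStarAlgebra B) (t : Fin D → B), IsCuntzFamily t → eval t a = 0) :
    seminorm a = 0 :=
  le_antisymm (seminorm_le le_rfl fun B _ t ht => by rw [h B _ t ht, norm_zero])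
    (seminorm_nonneg a)

def addGroupSeminorm (D : ℕ) : AddGroupSeminorm (CuntzFree D) where
  toFun := seminorm
  map_zero' := seminorm_eq_zero fun _ _ _ _ => map_zero _
  add_le' a b := seminorm_le (add_nonneg (seminorm_nonneg a) (seminorm_nonneg b))
    fun B _ t ht => by
      rw [map_add]
      exact (norm_add_le _ _).trans
        (add_le_add (norm_eval_le_seminorm ht a) (norm_eval_le_seminorm ht b))
  neg' a := by
    have key : ∀ a : CuntzFree D, seminorm (-a) ≤ seminorm a := fun a =>
      seminorm_le (seminorm_nonneg a) fun B _ t ht => by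
        rw [map_neg, norm_neg]
        exact norm_eval_le_seminorm ht a
    refine le_antisymm (key a) ?_
    have h := key (-a)
    rwa [neg_neg] at h

instance : SeminormedRing (CuntzFree D) where
  __ := (addGroupSeminorm D).toSeminormedAddCommGroup
  __ := (inferInstance : Ring (CuntzFree D))
  norm_mul_le a b := seminorm_le (mul_nonneg (seminorm_nonneg a) (seminorm_nonneg b))
    fun B _ t ht => by
      rw [map_mul]
      exact (norm_mul_le _ _).trans
        (mul_le_mul (norm_eval_le_seminorm ht a) (norm_eval_le_seminorm ht b) (norm_nonneg _)
          (seminorm_nonneg a))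

theorem norm_def (a : CuntzFree D) : ‖a‖ = seminorm a := rfl

instance : NormedAlgebra ℂ (CuntzFree D) where
  norm_smul_le r a := seminorm_le (mul_nonneg (norm_nonneg r) (seminorm_nonneg a))
    fun B _ t ht => by
      rw [map_smul, norm_smul]
      exact mul_le_mul_of_nonneg_left (norm_eval_le_seminorm ht a) (norm_nonneg r)

theorem norm_star_le (a : CuntzFree D) : ‖star a‖ ≤ ‖a‖ :=
  seminorm_le (seminorm_nonneg a) fun B _ t ht => by
    rw [map_star, norm_star]
    exact norm_eval_le_seminorm ht a

theorem norm_star' (a : CuntzFree D) : ‖star a‖ = ‖a‖ := by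
  refine le_antisymm (norm_star_le a) ?_
  have h := norm_star_le (star a)
  rwa [star_star] at h

theorem norm_mul_norm_le (a : CuntzFree D) : ‖a‖ * ‖a‖ ≤ ‖star a * a‖ := by
  have h : ‖a‖ ≤ Real.sqrt ‖star a * a‖ :=
    seminorm_le (Real.sqrt_nonneg _) fun B _ t ht => by
      refine Real.le_sqrt_of_sq_le ?_
      rw [sq, ← CStarRing.norm_star_mul_self, ← map_star, ← map_mul]
      exact norm_eval_le_seminorm ht _
  calc ‖a‖ * ‖a‖ ≤ Real.sqrt ‖star a * a‖ * Real.sqrt ‖star a * a‖ :=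
        mul_self_le_mul_self (norm_nonneg a) h
    _ = ‖star a * a‖ := Real.mul_self_sqrt (norm_nonneg _)

theorem isometry_star : Isometry (star : CuntzFree D → CuntzFree D) :=
  Isometry.of_dist_eq fun a b => by
    rw [dist_eq_norm, dist_eq_norm, ← star_sub, norm_star']

end CuntzFree

/-- The Cuntz algebra `𝒪_D`: the universal C*-algebra generated by a Cuntz family of length `D`,
i.e. the (separated) completion of the free `*`-algebra in the universal C*-seminorm. -/
def CuntzAlgebra (D : ℕ) : Type := UniformSpace.Completion (CuntzFree D)

namespace CuntzAlgebra

open UniformSpace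

variable {D : ℕ}

instance : NormedRing (CuntzAlgebra D) :=
  inferInstanceAs (NormedRing (Completion (CuntzFree D)))

instance : CompleteSpace (CuntzAlgebra D) :=
  inferInstanceAs (CompleteSpace (Completion (CuntzFree D)))

instance : Algebra ℂ (CuntzAlgebra D) :=
  inferInstanceAs (Algebra ℂ (Completion (CuntzFree D)))

instance : NormedAlgebra ℂ (CuntzAlgebra D) where
  norm_smul_le r a := norm_smul_le (β := Completion (CuntzFree D)) r a

/-- The canonical map from the free `*`-algebra. -/
def ofFree : CuntzFree D →ₐ[ℂ] CuntzAlgebra D where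
  __ := (Completion.coeRingHom : CuntzFree D →+* Completion (CuntzFree D))
  commutes' _ := rfl

theorem norm_ofFree (a : CuntzFree D) : ‖ofFree a‖ = ‖a‖ := Completion.norm_coe a

theorem isometry_ofFree : Isometry (ofFree : CuntzFree D → CuntzAlgebra D) :=
  AddMonoidHomClass.isometry_of_norm _ norm_ofFree

theorem denseRange_ofFree : DenseRange (ofFree : CuntzFree D → CuntzAlgebra D) :=
  Completion.denseRange_coe

theorem induct {motive : CuntzAlgebra D → Prop} (a : CuntzAlgebra D)
    (hc : IsClosed {a | motive a}) (h : ∀ a, motive (ofFree a)) : motive a :=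
  denseRange_ofFree.induction_on a hc h

theorem induct₂ {motive : CuntzAlgebra D → CuntzAlgebra D → Prop} (a b : CuntzAlgebra D)
    (hc : IsClosed {x : CuntzAlgebra D × CuntzAlgebra D | motive x.1 x.2})
    (h : ∀ a b, motive (ofFree a) (ofFree b)) : motive a b :=
  denseRange_ofFree.induction_on₂ hc h a b

instance : Star (CuntzAlgebra D) where
  star := Completion.map (star : CuntzFree D → CuntzFree D)

theorem star_ofFree (a : CuntzFree D) : star (ofFree a) = ofFree (star a) :=
  Completion.map_coe CuntzFree.isometry_star.uniformContinuous a

theorem continuous_star' : Continuous (star : CuntzAlgebra D → CuntzAlgebra D) :=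
  Completion.continuous_map

instance : ContinuousStar (CuntzAlgebra D) := ⟨continuous_star'⟩

instance : StarRing (CuntzAlgebra D) where
  star_involutive a := by
    refine induct (motive := fun a => star (star a) = a) a
      (isClosed_eq (by fun_prop) (by fun_prop)) fun a => ?_
    rw [star_ofFree, star_ofFree, star_star]
  star_mul a b := by
    refine induct₂ (motive := fun a b => star (a * b) = star b * star a) a b
      (isClosed_eq (by fun_prop) (by fun_prop)) fun a b => ?_
    rw [← map_mul, star_ofFree, star_ofFree, star_ofFree, star_mul, map_mul]
  star_add a b := by
    refine induct₂ (motive := fun a b => star (a + b) = star a + star b) a b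
      (isClosed_eq (by fun_prop) (by fun_prop)) fun a b => ?_
    rw [← map_add, star_ofFree, star_ofFree, star_ofFree, star_add, map_add]

theorem star_smul' (r : ℂ) (a : CuntzAlgebra D) : star (r • a) = star r • star a := by
  refine induct (motive := fun a => star (r • a) = star r • star a) a
    (isClosed_eq (continuous_const_smul r).star (continuous_star'.const_smul (star r)))
    fun a => ?_
  rw [← map_smul, star_ofFree, star_ofFree, star_smul, map_smul]

theorem norm_mul_self_le' (a : CuntzAlgebra D) : ‖a‖ * ‖a‖ ≤ ‖star a * a‖ := by
  refine induct (motive := fun a => ‖a‖ * ‖a‖ ≤ ‖star a * a‖) a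
    (isClosed_le (by fun_prop) (by fun_prop)) fun a => ?_
  rw [star_ofFree, ← map_mul, norm_ofFree, norm_ofFree]
  exact CuntzFree.norm_mul_norm_le a

instance : CStarAlgebra (CuntzAlgebra D) where
  star_smul := star_smul'
  norm_mul_self_le := norm_mul_self_le'

/-- The `i`-th generating isometry of `𝒪_D`. -/
def gen (i : Fin D) : CuntzAlgebra D := ofFree (CuntzFree.gen (i, false))

theorem ofFree_eq_of_eval {a b : CuntzFree D} (h : ∀ (B : Type) (_ : CStarAlgebra B)
    (t : Fin D → B), IsCuntzFamily t → CuntzFree.eval t a = CuntzFree.eval t b) :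
    ofFree a = ofFree b := by
  rw [← sub_eq_zero, ← map_sub, ← norm_eq_zero, norm_ofFree]
  refine CuntzFree.seminorm_eq_zero fun B _ t ht => ?_
  rw [map_sub, h B _ t ht, sub_self]

theorem isCuntzFamily_gen (D : ℕ) : IsCuntzFamily (gen : Fin D → CuntzAlgebra D) where
  star_mul_eq i j := by
    have h : ofFree (star (CuntzFree.gen (j, false)) * CuntzFree.gen (i, false)) =
        ofFree (if i = j then 1 else 0 : CuntzFree D) := by
      refine ofFree_eq_of_eval fun B _ t ht => ?_
      rw [map_mul, map_star, CuntzFree.eval_gen, CuntzFree.eval_gen]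
      simp only [Bool.false_eq_true, if_false]
      rw [ht.star_mul_eq]
      split_ifs <;> simp
    rw [gen, gen, star_ofFree, ← map_mul, h]
    split_ifs <;> simp
  sum_mul_star := by
    have h : ofFree (∑ i : Fin D, CuntzFree.gen (i, false) * star (CuntzFree.gen (i, false))) =
        ofFree (1 : CuntzFree D) := by
      refine ofFree_eq_of_eval fun B _ t ht => ?_
      rw [map_sum, map_one, ← ht.sum_mul_star]
      refine Finset.sum_congr rfl fun i _ => ?_
      rw [map_mul, map_star, CuntzFree.eval_gen]
      simp
    simp only [gen, star_ofFree, ← map_mul]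
    rw [← map_sum, h, map_one]

theorem hom_ext {B : Type*} [CStarAlgebra B] {φ ψ : CuntzAlgebra D →⋆ₐ[ℂ] B}
    (h : ∀ i, φ (gen i) = ψ (gen i)) : φ = ψ := by
  refine DFunLike.ext _ _ fun a => ?_
  have hc : ∀ φ : CuntzAlgebra D →⋆ₐ[ℂ] B, Continuous φ := fun φ =>
    AddMonoidHomClass.continuous_of_bound φ 1 fun a => by
      rw [one_mul]; exact NonUnitalStarAlgHom.norm_apply_le φ a
  refine induct (motive := fun a => φ a = ψ a) a (isClosed_eq (hc φ) (hc ψ)) fun a => ?_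
  induction a using CuntzFree.induct with
  | scalar r => rw [AlgHomClass.commutes, AlgHomClass.commutes, AlgHomClass.commutes]
  | gens x =>
    rcases x with ⟨i, _ | _⟩
    · exact h i
    · have e : ofFree (CuntzFree.gen (i, true)) = star (gen i) := by
        rw [gen, star_ofFree, CuntzFree.star_gen]; rfl
      rw [e, map_star, map_star, h i]
  | mul a b ha hb => rw [map_mul, map_mul, map_mul, ha, hb]
  | add a b ha hb => rw [map_add, map_add, map_add, ha, hb]

theorem exists_lift {B : Type} [CStarAlgebra B] {t : Fin D → B} (ht : IsCuntzFamily t) :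
    ∃ φ : CuntzAlgebra D →⋆ₐ[ℂ] B, ∀ i, φ (gen i) = t i := by
  have hcont : Continuous (CuntzFree.eval t) :=
    AddMonoidHomClass.continuous_of_bound (CuntzFree.eval t) 1 fun a => by
      rw [one_mul]; exact CuntzFree.norm_eval_le_seminorm ht a
  let ψ : CuntzAlgebra D →+* B :=
    Completion.extensionHom (CuntzFree.eval t : CuntzFree D →+* B) hcont
  have hψ : ∀ a, ψ (ofFree a) = CuntzFree.eval t a :=
    Completion.extensionHom_coe (CuntzFree.eval t : CuntzFree D →+* B) hcont
  have hψc : Continuous ψ := Completion.continuous_extension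
  refine ⟨{ ψ with
    commutes' := fun r => ?_
    map_star' := fun a => ?_ }, fun i => ?_⟩
  · exact (hψ (algebraMap ℂ _ r)).trans (AlgHomClass.commutes _ r)
  · change ψ (star a) = star (ψ a)
    refine induct (motive := fun a => ψ (star a) = star (ψ a)) a
      (isClosed_eq (by fun_prop) (by fun_prop)) fun a => ?_
    rw [star_ofFree, hψ, hψ, map_star]
  · exact (hψ _).trans (by simp [CuntzFree.eval_gen])

/-- The universal property: every Cuntz family in a unital C*-algebra `B` is the image of the
generators under a unique unital `*`-homomorphism `𝒪_D → B`. -/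
theorem existsUnique_lift {B : Type} [CStarAlgebra B] {t : Fin D → B} (ht : IsCuntzFamily t) :
    ∃! φ : CuntzAlgebra D →⋆ₐ[ℂ] B, ∀ i, φ (gen i) = t i := by
  obtain ⟨φ, hφ⟩ := exists_lift ht
  exact ⟨φ, hφ, fun ψ hψ => hom_ext fun i => (hψ i).trans (hφ i).symm⟩

end CuntzAlgebra
/-- Unitary equivalence of two representations of a C*-algebra on Hilbert spaces. -/
def UnitarilyEquivalent {𝒜 E F : Type*} [CStarAlgebra 𝒜]
    [NormedAddCommGroup E] [InnerProductSpace ℂ E] [CompleteSpace E]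
    [NormedAddCommGroup F] [InnerProductSpace ℂ F] [CompleteSpace F]
    (π : 𝒜 →⋆ₐ[ℂ] (E →L[ℂ] E)) (ρ : 𝒜 →⋆ₐ[ℂ] (F →L[ℂ] F)) : Prop :=
  ∃ U : E ≃ₗᵢ[ℂ] F, ∀ (a : 𝒜) (ξ : E), U (π a ξ) = ρ a (U ξ)

/-! ### Semibranching function systems -/

section Semibranching

variable {X : Type*} [MeasurableSpace X] {D : ℕ}

/-- A semibranching function system on `(X, μ)` with coding map `coding`. The measure
`μ ∘ σᵢ : B ↦ μ (σᵢ(B))` is `μ.comap (σ i)`. -/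
structure IsSemibranchingSystem (μ : Measure X) (σ : Fin D → X → X) (coding : X → X) :
    Prop where
  measurable : ∀ i, Measurable (σ i)
  compl_range_null : μ (⋃ i, Set.range (σ i))ᶜ = 0
  range_inter_null : ∀ i j, i ≠ j → μ (Set.range (σ i) ∩ Set.range (σ j)) = 0
  absolutelyContinuous : ∀ i, μ.comap (σ i) ≪ μ
  rnDeriv_pos : ∀ i, ∀ᵐ x ∂μ, 0 < (μ.comap (σ i)).rnDeriv μ x
  coding_comp : ∀ i, ∀ᵐ x ∂μ, coding (σ i x) = x

/-- `π` is the representation of `𝒪_D` on `L²(X, μ)` determined by a semibranching function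
system: `π(sᵢ) ξ (x) = χ_{σᵢ(X)}(x) (d(μ∘σᵢ)/dμ (σ x))^{-1/2} ξ(σ x)`. -/
def IsSemibranchingRep (μ : Measure X) (σ : Fin D → X → X) (coding : X → X)
    (π : CuntzAlgebra D →⋆ₐ[ℂ] (Lp ℂ 2 μ →L[ℂ] Lp ℂ 2 μ)) : Prop :=
  ∀ (i : Fin D) (ξ : Lp ℂ 2 μ),
    (π (CuntzAlgebra.gen i) ξ : X → ℂ) =ᵐ[μ]
      (Set.range (σ i)).indicator fun x =>
        ((((μ.comap (σ i)).rnDeriv μ (coding x)).toReal ^ (-(1 / 2) : ℝ) : ℝ) : ℂ) *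
          (ξ : X → ℂ) (coding x)

end Semibranching

/-! ### The Sierpinski fractal of a 0-1 matrix -/

section Sierpinski

variable {N : ℕ}

/-- The point of the plane whose coordinates have the `N`-adic digits `x₁x₂…` and `y₁y₂…`
(the sequences are indexed from `0` here). -/
def nadicPoint (x y : ℕ → Fin N) : EuclideanSpace ℝ (Fin 2) :=
  !₂[∑' i : ℕ, (x i : ℝ) / (N : ℝ) ^ (i + 1), ∑' i : ℕ, (y i : ℝ) / (N : ℝ) ^ (i + 1)]

/-- The Sierpinski fractal `𝕊_A`. -/
def sierpinskiSet (A : Matrix (Fin N) (Fin N) ℕ) : Set (EuclideanSpace ℝ (Fin 2)) :=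
  {p | ∃ x y : ℕ → Fin N, (∀ i, A (x i) (y i) = 1) ∧ p = nadicPoint x y}

/-- The positions `(a, b)` of the ones of `A`, with the lexicographic order. -/
abbrev OneEntry (A : Matrix (Fin N) (Fin N) ℕ) : Type :=
  {c : Fin N ×ₗ Fin N // A (ofLex c).1 (ofLex c).2 = 1}

theorem tsum_cons_digit (c : Fin N) (x : ℕ → Fin N) :
    ∑' i : ℕ, ((Nat.casesOn i c x : Fin N) : ℝ) / (N : ℝ) ^ (i + 1) =
      (∑' i : ℕ, (x i : ℝ) / (N : ℝ) ^ (i + 1)) / N + c / N := by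
  have h := Real.ofDigits_eq_sum_add_ofDigits (fun i : ℕ => (Nat.casesOn i c x : Fin N)) 1
  simp only [Real.ofDigits, Real.ofDigitsTerm, ← div_eq_mul_inv, Finset.sum_range_one,
    pow_one, zero_add] at h
  rw [h, add_comm, inv_mul_eq_div]
  rfl

/-- `τ_{(a,b)}(x, y) = (x/N + a/N, y/N + b/N)` as a self-map of `𝕊_A`, for `A_{a,b} = 1`. -/
def sierpinskiMap (A : Matrix (Fin N) (Fin N) ℕ) (c : OneEntry A) (p : sierpinskiSet A) :
    sierpinskiSet A :=
  ⟨!₂[p.1 0 / N + ((ofLex c.1).1 : ℝ) / N, p.1 1 / N + ((ofLex c.1).2 : ℝ) / N], by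
    obtain ⟨p, x, y, hxy, rfl⟩ := p
    refine ⟨fun i => Nat.casesOn i (ofLex c.1).1 x, fun i => Nat.casesOn i (ofLex c.1).2 y,
      fun i => ?_, ?_⟩
    · cases i with
      | zero => exact c.2
      | succ i => exact hxy i
    · simp only [nadicPoint, tsum_cons_digit]
      simp⟩

/-- `τ` is a coding map of `𝕊_A`: `τ(x, y) = (N(x - x₁/N), N(y - y₁/N))`, where `x₁, y₁` are the
first digits of an admissible expansion of the point `(x, y)`. Points that have several admissible
expansions admit several choices. -/
def IsSierpinskiCoding (A : Matrix (Fin N) (Fin N) ℕ) (τ : sierpinskiSet A → sierpinskiSet A) :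
    Prop :=
  ∀ p : sierpinskiSet A, ∃ x y : ℕ → Fin N, (∀ i, A (x i) (y i) = 1) ∧
    (p : EuclideanSpace ℝ (Fin 2)) = nadicPoint x y ∧
    (τ p : EuclideanSpace ℝ (Fin 2)) =
      !₂[(N : ℝ) * (p.1 0 - (x 0 : ℝ) / N), (N : ℝ) * (p.1 1 - (y 0 : ℝ) / N)]

/-- The Hausdorff measure on `𝕊_A` of dimension `log D / log N`, `D` the number of ones of `A`. -/
def sierpinskiHausdorff (A : Matrix (Fin N) (Fin N) ℕ) : Measure (sierpinskiSet A) :=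
  Measure.hausdorffMeasure (Real.log (Nat.card (OneEntry A)) / Real.log N)

/-- The Hausdorff measure `H` on `𝕊_A`, normalized to total mass one. -/
def sierpinskiMeasure (A : Matrix (Fin N) (Fin N) ℕ) : Measure (sierpinskiSet A) :=
  (sierpinskiHausdorff A Set.univ)⁻¹ • sierpinskiHausdorff A

end Sierpinski

/-! ### Monic systems on the Cantor group -/

section Monic

variable {D : ℕ}

/-- The Cantor group `K_D = ∏ ℤ_D`, with its product (Borel) `σ`-algebra. -/
abbrev CantorGroup (D : ℕ) : Type := ℕ → Fin D

/-- `σⱼ(i₁i₂…) = j i₁i₂…`. -/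
def prependDigit (j : Fin D) (x : CantorGroup D) : CantorGroup D := fun n => Nat.casesOn n j x

/-- The one-sided shift `σ(i₁i₂…) = i₂i₃…`. -/
def cantorShift (x : CantorGroup D) : CantorGroup D := fun n => x (n + 1)

/-- The measure `ν_D`: the infinite product of the uniform measures, so that every cylinder set
`[n₁…n_m]` has measure `D^{-m}`. -/
def cantorMeasure (D : ℕ) : Measure (CantorGroup D) :=
  Measure.infinitePi fun _ : ℕ => ProbabilityTheory.uniformOn (Set.univ : Set (Fin D))

/-- A nonnegative monic system `(μ, (fᵢ))`; `μ ∘ σᵢ⁻¹` is `μ.map σᵢ`. -/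
structure IsNonnegMonicSystem (μ : Measure (CantorGroup D))
    (f : Fin D → CantorGroup D → ℝ) : Prop where
  isProbabilityMeasure : IsProbabilityMeasure μ
  measurable : ∀ i, Measurable (f i)
  nonneg : ∀ i x, 0 ≤ f i x
  memLp : ∀ i, MemLp (f i) 2 μ
  absolutelyContinuous : ∀ i, μ.map (prependDigit i) ≪ μ
  rnDeriv_eq : ∀ i, (μ.map (prependDigit i)).rnDeriv μ =ᵐ[μ] fun x => ENNReal.ofReal (f i x ^ 2)
  ne_zero : ∀ i, ∀ᵐ x ∂μ, x ∈ Set.range (prependDigit i) → f i x ≠ 0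

/-- `π` is the representation of `𝒪_D` on `L²(K_D, μ)` attached to `(μ, (fᵢ))`:
`π(sᵢ) ξ = fᵢ · (ξ ∘ σ)`. -/
def IsMonicRep (μ : Measure (CantorGroup D)) (f : Fin D → CantorGroup D → ℝ)
    (π : CuntzAlgebra D →⋆ₐ[ℂ] (Lp ℂ 2 μ →L[ℂ] Lp ℂ 2 μ)) : Prop :=
  ∀ (i : Fin D) (ξ : Lp ℂ 2 μ),
    (π (CuntzAlgebra.gen i) ξ : CantorGroup D → ℂ) =ᵐ[μ]
      fun x => (f i x : ℂ) * (ξ : CantorGroup D → ℂ) (cantorShift x)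

/-- The functions `fᵢ = √D χ_{σᵢ(K_D)}` of the standard positive monic system `(ν_D, (fᵢ))`. -/
def standardMonicFun (D : ℕ) (i : Fin D) : CantorGroup D → ℝ :=
  (Set.range (prependDigit i)).indicator fun _ => Real.sqrt D

end Monic

end

/-! ### The uniform product measure on the Cantor group and its self-similarity. -/

section CantorMeasure

open Set ProbabilityTheory
open scoped ENNReal

variable {D : ℕ}

/-! Let `c` send a sequence of letters to the point of `𝕊_A` with those digit pairs. It turns
prepending a letter into `τ_j` and, where the coding is unique, the shift into `τ`. The claim is
that `c` is an isomorphism of measure spaces modulo null sets; then `ξ ↦ ξ ∘ c` is the required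
unitary.

With `s = log D / log N` one has `N ^ s = D`, and `τ_j` is a similarity of ratio `1 / N`, so it
scales `s`-dimensional Hausdorff measure by `1 / D`. Cylinder covers show that the total mass is
finite, and the mass distribution principle, applied to the image of `ν_D`, shows that it is
positive (`sierpinskiHausdorff_univ_ne_top`, `sierpinskiHausdorff_univ_ne_zero`), so `H` is a
probability measure. Now `D` pieces of mass `1 / D` cover a space of mass `1`, so they overlap in
null sets (`measure_range_inter`), and the points with several codings form a null set. Off it `c`
has a measurable inverse `s`. The image of `H` under `s` is the average of its images under the maps
`σ_j`, and `ν_D` is the only such probability measure (`IsDigitInvariant.eq_cantorMeasure`); hence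
`c` and `s` preserve measure.

The derivative of `H ∘ τ_j` is the constant `1 / D`, whose power `-1/2` is the `√D` of the standard
monic system, so the unitary matches the two formulas on generators. The Cuntz relations are
verified only on the Cantor side, and `π` is transported from there. Uniqueness holds because a
`*`-homomorphism on `𝒪_D` is determined by the generators. -/

theorem cantorShift_prependDigit (j : Fin D) (x : CantorGroup D) :
    cantorShift (prependDigit j x) = x := rfl

theorem prependDigit_cantorShift (x : CantorGroup D) :
    prependDigit (x 0) (cantorShift x) = x := by
  funext n
  cases n <;> rfl

theorem mem_range_prependDigit {j : Fin D} {x : CantorGroup D} :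
    x ∈ range (prependDigit j) ↔ x 0 = j := by
  constructor
  · rintro ⟨y, rfl⟩
    rfl
  · rintro rfl
    exact ⟨_, prependDigit_cantorShift x⟩

theorem range_prependDigit (j : Fin D) : range (prependDigit j) = (fun x => x 0) ⁻¹' {j} := by
  ext x
  exact mem_range_prependDigit

theorem measurable_prependDigit (j : Fin D) : Measurable (prependDigit j) := by
  refine measurable_pi_iff.2 fun n => ?_
  cases n with
  | zero => exact measurable_const
  | succ n => exact measurable_pi_apply n

theorem measurable_cantorShift : Measurable (cantorShift : CantorGroup D → CantorGroup D) :=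
  measurable_pi_iff.2 fun n => measurable_pi_apply (n + 1)

theorem measurableSet_range_prependDigit (j : Fin D) :
    MeasurableSet (range (prependDigit j)) := by
  rw [range_prependDigit]
  exact measurable_pi_apply 0 (measurableSet_singleton j)

/-- The measure is the average of its images under the maps `σⱼ`. -/
def IsDigitInvariant (μ : Measure (CantorGroup D)) : Prop :=
  (D : ℝ≥0∞)⁻¹ • ∑ j : Fin D, μ.map (prependDigit j) = μ

theorem average_map_prependDigit_apply (μ : Measure (CantorGroup D)) {E : Set (CantorGroup D)}
    (hE : MeasurableSet E) :
    ((D : ℝ≥0∞)⁻¹ • ∑ j : Fin D, μ.map (prependDigit j)) E =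
      (D : ℝ≥0∞)⁻¹ * ∑ j : Fin D, μ (prependDigit j ⁻¹' E) := by
  rw [Measure.smul_apply, Measure.finsetSum_apply, smul_eq_mul]
  congr 1
  exact Finset.sum_congr rfl fun j _ => Measure.map_apply (measurable_prependDigit j) hE

theorem measurableSet_pi_finset (s : Finset ℕ) (t : ℕ → Set (Fin D)) :
    MeasurableSet ((s : Set ℕ).pi t) :=
  MeasurableSet.pi s.countable_toSet fun _ _ => MeasurableSet.of_discrete

/-- Only the letters in `t 0` contribute, and their proportion among all `D` letters is the uniform
measure of `t 0`. This recursion in the length of the box drives both the invariance of `ν_D` and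
its uniqueness. -/
theorem average_map_prependDigit_pi (μ : Measure (CantorGroup D)) (n : ℕ)
    (t : ℕ → Set (Fin D)) :
    ((D : ℝ≥0∞)⁻¹ • ∑ j : Fin D, μ.map (prependDigit j))
        ((Finset.range (n + 1) : Set ℕ).pi t) =
      uniformOn univ (t 0) * μ ((Finset.range n : Set ℕ).pi fun i => t (i + 1)) := by
  classical
  rw [average_map_prependDigit_apply μ (measurableSet_pi_finset _ _)]
  have h : ∀ j : Fin D, μ (prependDigit j ⁻¹' (Finset.range (n + 1) : Set ℕ).pi t) =
      (if j ∈ t 0 then 1 else 0) * μ ((Finset.range n : Set ℕ).pi fun i => t (i + 1)) := by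
    intro j
    split_ifs with hj
    · rw [one_mul]
      congr 1
      ext x
      constructor
      · intro hx i hi
        exact hx (i + 1) (by simpa using hi)
      · intro hx i hi
        cases i with
        | zero => exact hj
        | succ i => exact hx i (by simpa using hi)
    · rw [zero_mul]
      convert measure_empty (μ := μ)
      rw [eq_empty_iff_forall_notMem]
      intro x hx
      exact hj (hx 0 (by simp))
  rw [Finset.sum_congr rfl fun j _ => h j, ← Finset.sum_mul, ← mul_assoc]
  congr 1
  rw [uniformOn_univ, Fintype.card_fin, ENNReal.div_eq_inv_mul,
    Measure.count_apply_finite _ (toFinite (t 0))]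
  congr 1
  rw [Finset.sum_ite, Finset.sum_const_zero, add_zero, Finset.sum_const, nsmul_one]
  congr 2
  ext j
  simp

theorem standardMonicFun_eq (i : Fin D) (x : CantorGroup D) :
    standardMonicFun D i x = if x 0 = i then Real.sqrt D else 0 := by
  classical
  rw [standardMonicFun, indicator_apply]
  simp only [mem_range_prependDigit]

theorem measurable_standardMonicFun (i : Fin D) : Measurable (standardMonicFun D i) :=
  measurable_const.indicator (measurableSet_range_prependDigit i)

variable [NeZero D]

/-- A box over any finite set of coordinates is a box over an initial segment, with `univ` in the
added coordinates, so initial segments suffice. -/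
theorem eq_cantorMeasure {μ : Measure (CantorGroup D)}
    (h : ∀ (n : ℕ) (t : ℕ → Set (Fin D)), μ ((Finset.range n : Set ℕ).pi t) =
      ∏ i ∈ Finset.range n, uniformOn univ (t i)) : μ = cantorMeasure D := by
  classical
  refine Measure.eq_infinitePi _ fun s t _ => ?_
  obtain ⟨n, hn⟩ := Finset.exists_nat_subset_range s
  have h1 : (s : Set ℕ).pi t =
      (Finset.range n : Set ℕ).pi fun i => if i ∈ s then t i else univ := by
    ext x
    simp only [mem_pi, Finset.mem_coe]
    constructor
    · intro hx i _
      split_ifs with hi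
      · exact hx i hi
      · trivial
    · intro hx i hi
      have := hx i (hn hi)
      rwa [if_pos hi] at this
  rw [h1, h, ← Finset.prod_subset hn]
  · exact Finset.prod_congr rfl fun i hi => by rw [if_pos hi]
  · intro i _ hi
    rw [if_neg hi, measure_univ]

instance : IsProbabilityMeasure (cantorMeasure D) := by
  unfold cantorMeasure
  infer_instance

theorem natCast_inv_mul_cancel : (D : ℝ≥0∞)⁻¹ * D = 1 :=
  ENNReal.inv_mul_cancel (by simp [NeZero.ne D]) (ENNReal.natCast_ne_top D)

theorem isDigitInvariant_cantorMeasure : IsDigitInvariant (cantorMeasure D) := by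
  refine eq_cantorMeasure fun n t => ?_
  cases n with
  | zero =>
    rw [average_map_prependDigit_apply _ (measurableSet_pi_finset _ _)]
    simp [natCast_inv_mul_cancel]
  | succ n =>
    rw [average_map_prependDigit_pi, Finset.prod_range_succ', mul_comm]
    congr 1
    exact Measure.infinitePi_pi _ fun _ _ => MeasurableSet.of_discrete

/-- Invariance determines the mass of boxes of length `n + 1` from those of length `n`; total mass
one starts the induction. -/
theorem IsDigitInvariant.eq_cantorMeasure {μ : Measure (CantorGroup D)} [IsProbabilityMeasure μ]
    (h : IsDigitInvariant μ) : μ = cantorMeasure D := by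
  refine _root_.eq_cantorMeasure fun n => ?_
  induction n with
  | zero => intro t; simp
  | succ n ih =>
    intro t
    rw [← h, average_map_prependDigit_pi, Finset.prod_range_succ', mul_comm, ih]

theorem cantorMeasure_apply {E : Set (CantorGroup D)} (hE : MeasurableSet E) :
    cantorMeasure D E =
      (D : ℝ≥0∞)⁻¹ * ∑ j : Fin D, cantorMeasure D (prependDigit j ⁻¹' E) := by
  rw [← average_map_prependDigit_apply _ hE, isDigitInvariant_cantorMeasure]

/-- On subsets of the cylinder of `i`, only the `i`-th term of the average survives, so the factor
`1 / D` can be inverted. -/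
theorem map_prependDigit_cantorMeasure (i : Fin D) :
    (cantorMeasure D).map (prependDigit i) =
      (D : ℝ≥0∞) • (cantorMeasure D).restrict (range (prependDigit i)) := by
  ext E hE
  rw [Measure.smul_apply, Measure.restrict_apply hE,
    Measure.map_apply (measurable_prependDigit i) hE,
    cantorMeasure_apply (hE.inter (measurableSet_range_prependDigit i)), smul_eq_mul, ← mul_assoc,
    mul_comm (D : ℝ≥0∞), natCast_inv_mul_cancel, one_mul, Finset.sum_eq_single i]
  · rw [preimage_inter, preimage_range, inter_univ]
  · intro j _ hj
    convert measure_empty (μ := cantorMeasure D)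
    rw [eq_empty_iff_forall_notMem]
    rintro x ⟨-, hx⟩
    exact hj (mem_range_prependDigit.1 hx)
  · simp

theorem quasiMeasurePreserving_prependDigit (i : Fin D) :
    Measure.QuasiMeasurePreserving (prependDigit i) (cantorMeasure D) (cantorMeasure D) := by
  refine ⟨measurable_prependDigit i, ?_⟩
  rw [map_prependDigit_cantorMeasure]
  exact (Measure.smul_absolutelyContinuous).trans Measure.restrict_le_self.absolutelyContinuous

theorem measurePreserving_cantorShift :
    MeasurePreserving cantorShift (cantorMeasure D) (cantorMeasure D) := by
  refine ⟨measurable_cantorShift, ?_⟩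
  ext E hE
  rw [Measure.map_apply measurable_cantorShift hE, cantorMeasure_apply (measurable_cantorShift hE)]
  simp only [← preimage_comp]
  have : ∀ j : Fin D, cantorShift ∘ prependDigit j = id := fun j => rfl
  simp [this, ← mul_assoc, natCast_inv_mul_cancel]

theorem isNonnegMonicSystem_standard :
    IsNonnegMonicSystem (cantorMeasure D) (standardMonicFun D) where
  isProbabilityMeasure := inferInstance
  measurable := measurable_standardMonicFun
  nonneg i x := indicator_nonneg (fun _ _ => Real.sqrt_nonneg _) x
  memLp i := (memLp_const _).indicator (measurableSet_range_prependDigit i)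
  absolutelyContinuous i := (quasiMeasurePreserving_prependDigit i).absolutelyContinuous
  rnDeriv_eq i := by
    have h : (cantorMeasure D).map (prependDigit i) =
        (cantorMeasure D).withDensity fun x => ENNReal.ofReal (standardMonicFun D i x ^ 2) := by
      have h1 : (fun x => ENNReal.ofReal (standardMonicFun D i x ^ 2)) =
          (range (prependDigit i)).indicator fun _ => (D : ℝ≥0∞) := by
        classical
        funext x
        rw [standardMonicFun_eq, indicator_apply]
        simp only [mem_range_prependDigit]
        split_ifs
        · rw [Real.sq_sqrt (Nat.cast_nonneg D), ENNReal.ofReal_natCast]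
        · simp
      rw [h1, withDensity_indicator (measurableSet_range_prependDigit i), withDensity_const,
        map_prependDigit_cantorMeasure]
    rw [h]
    exact Measure.rnDeriv_withDensity _ ((measurable_standardMonicFun i).pow_const 2).ennreal_ofReal
  ne_zero i := ae_of_all _ fun x hx => by
    rw [standardMonicFun_eq, if_pos (mem_range_prependDigit.1 hx)]
    exact (Real.sqrt_pos.2 (Nat.cast_pos.2 (NeZero.pos D))).ne'

end CantorMeasure

/-! ### The standard monic representation on the Cantor group. -/

section MonicRep

open Set ProbabilityTheory
open scoped ENNReal InnerProductSpace

variable {D : ℕ}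

theorem IsMonicRep.ext {μ : Measure (CantorGroup D)} {f : Fin D → CantorGroup D → ℝ}
    {ρ ρ' : CuntzAlgebra D →⋆ₐ[ℂ] (Lp ℂ 2 μ →L[ℂ] Lp ℂ 2 μ)} (h : IsMonicRep μ f ρ)
    (h' : IsMonicRep μ f ρ') : ρ = ρ' :=
  CuntzAlgebra.hom_ext fun i => ContinuousLinearMap.ext fun ξ =>
    Lp.ext ((h i ξ).trans (h' i ξ).symm)

theorem IsSemibranchingRep.ext {X : Type} [MeasurableSpace X] {μ : Measure X}
    {σ : Fin D → X → X} {coding : X → X}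
    {π π' : CuntzAlgebra D →⋆ₐ[ℂ] (Lp ℂ 2 μ →L[ℂ] Lp ℂ 2 μ)}
    (h : IsSemibranchingRep μ σ coding π) (h' : IsSemibranchingRep μ σ coding π') : π = π' :=
  CuntzAlgebra.hom_ext fun i => ContinuousLinearMap.ext fun ξ =>
    Lp.ext ((h i ξ).trans (h' i ξ).symm)

variable [NeZero D]

theorem integral_cantorMeasure {E : Type*} [NormedAddCommGroup E] [NormedSpace ℝ E]
    {h : CantorGroup D → E} (hh : Integrable h (cantorMeasure D)) :
    ∫ x, h x ∂cantorMeasure D =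
      (D : ℝ)⁻¹ • ∑ k : Fin D, ∫ x, h (prependDigit k x) ∂cantorMeasure D := by
  have hint : ∀ k : Fin D, Integrable h ((cantorMeasure D).map (prependDigit k)) := fun k => by
    rw [map_prependDigit_cantorMeasure]
    exact hh.restrict.smul_measure (ENNReal.natCast_ne_top D)
  conv_lhs => rw [← isDigitInvariant_cantorMeasure (D := D)]
  rw [integral_smul_measure, integral_finsetSum_measure fun k _ => hint k]
  congr 1
  · simp
  · exact Finset.sum_congr rfl fun k _ =>
      integral_map (measurable_prependDigit k).aemeasurable (hint k).aestronglyMeasurable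

theorem memLp_monic {f : CantorGroup D → ℂ} (hf : MemLp f 2 (cantorMeasure D)) (i : Fin D) :
    MemLp (fun x => (standardMonicFun D i x : ℂ) * f (cantorShift x)) 2 (cantorMeasure D) := by
  have h := ((hf.comp_measurePreserving measurePreserving_cantorShift).const_mul
    (Real.sqrt D : ℂ)).indicator (measurableSet_range_prependDigit i)
  convert h using 1
  classical
  funext x
  rw [standardMonicFun_eq, indicator_apply]
  simp only [mem_range_prependDigit]
  split_ifs <;> simp

/-- The operator `f ↦ fᵢ · (f ∘ σ)` on `L²(K_D, ν_D)`. -/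
noncomputable def monicLinearMap (i : Fin D) :
    Lp ℂ 2 (cantorMeasure D) →ₗ[ℂ] Lp ℂ 2 (cantorMeasure D) where
  toFun f := (memLp_monic (Lp.memLp f) i).toLp _
  map_add' f g := by
    rw [← MemLp.toLp_add]
    refine MemLp.toLp_congr _ _ ?_
    filter_upwards [measurePreserving_cantorShift.quasiMeasurePreserving.ae (Lp.coeFn_add f g)]
      with x hx
    rw [hx, Pi.add_apply, Pi.add_apply, mul_add]
  map_smul' c f := by
    rw [RingHom.id_apply, ← MemLp.toLp_const_smul]
    refine MemLp.toLp_congr _ _ ?_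
    filter_upwards [measurePreserving_cantorShift.quasiMeasurePreserving.ae (Lp.coeFn_smul c f)]
      with x hx
    rw [hx, Pi.smul_apply, Pi.smul_apply, smul_eq_mul, smul_eq_mul, mul_left_comm]

theorem coeFn_monicLinearMap (i : Fin D) (f : Lp ℂ 2 (cantorMeasure D)) :
    monicLinearMap i f =ᵐ[cantorMeasure D]
      fun x => (standardMonicFun D i x : ℂ) * f (cantorShift x) :=
  (memLp_monic (Lp.memLp f) i).coeFn_toLp

/-- Split the integral by the first letter `k`. The integrand vanishes unless `k = i = j`, and then
`√D * √D = D` cancels the weight `1 / D` of the cylinder. -/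
theorem inner_monicLinearMap (i j : Fin D) (f g : Lp ℂ 2 (cantorMeasure D)) :
    ⟪monicLinearMap i f, monicLinearMap j g⟫_ℂ = if i = j then ⟪f, g⟫_ℂ else 0 := by
  classical
  rw [L2.inner_def, integral_cantorMeasure (L2.integrable_inner _ _)]
  have h : ∀ k : Fin D, ∫ x, ⟪(monicLinearMap i f : CantorGroup D → ℂ) (prependDigit k x),
      (monicLinearMap j g : CantorGroup D → ℂ) (prependDigit k x)⟫_ℂ ∂cantorMeasure D =
      if k = i then (if i = j then (D : ℝ) • ⟪f, g⟫_ℂ else 0) else 0 := by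
    intro k
    have h1 : (fun x => ⟪(monicLinearMap i f : CantorGroup D → ℂ) (prependDigit k x),
        (monicLinearMap j g : CantorGroup D → ℂ) (prependDigit k x)⟫_ℂ) =ᵐ[cantorMeasure D]
        fun x => (if k = i then (if i = j then (D : ℝ) else 0) else 0) • ⟪f x, g x⟫_ℂ := by
      filter_upwards [(quasiMeasurePreserving_prependDigit k).ae (coeFn_monicLinearMap i f),
        (quasiMeasurePreserving_prependDigit k).ae (coeFn_monicLinearMap j g)] with x hf hg
      rw [hf, hg, cantorShift_prependDigit, standardMonicFun_eq, standardMonicFun_eq]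
      have hk : prependDigit k x 0 = k := rfl
      rw [hk]
      by_cases hki : k = i
      · subst hki
        by_cases hkj : k = j
        · subst hkj
          have hD : ((Real.sqrt D : ℝ) : ℂ) * (Real.sqrt D : ℝ) = D := by
            rw [← Complex.ofReal_mul, Real.mul_self_sqrt (Nat.cast_nonneg D)]
            simp
          simp only [if_true, RCLike.inner_apply, map_mul, Complex.conj_ofReal,
            Complex.real_smul]
          push_cast
          rw [← hD]
          ring
        · simp [hkj]
      · simp [hki]
    rw [integral_congr_ae h1, integral_smul, ← L2.inner_def]
    split_ifs <;> simp
  rw [Finset.sum_congr rfl fun k _ => h k, Finset.sum_ite_eq' Finset.univ i]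
  simp only [Finset.mem_univ, if_true]
  split_ifs
  · rw [smul_smul, inv_mul_cancel₀ (Nat.cast_ne_zero.2 (NeZero.ne D)), one_smul]
  · exact smul_zero _

/-- The isometry `f ↦ fᵢ · (f ∘ σ)` of `L²(K_D, ν_D)`. -/
noncomputable def monicIsometry (i : Fin D) :
    Lp ℂ 2 (cantorMeasure D) →L[ℂ] Lp ℂ 2 (cantorMeasure D) :=
  ((monicLinearMap i).isometryOfInner fun f g => by
    rw [inner_monicLinearMap, if_pos rfl]).toContinuousLinearMap

theorem monicIsometry_apply (i : Fin D) (f : Lp ℂ 2 (cantorMeasure D)) :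
    monicIsometry i f = monicLinearMap i f := rfl

theorem memLp_prepend (g : Lp ℂ 2 (cantorMeasure D)) (i : Fin D) :
    MemLp (fun x => ((Real.sqrt D : ℝ) : ℂ)⁻¹ * g (prependDigit i x)) 2 (cantorMeasure D) := by
  refine MemLp.const_mul ?_ _
  refine MemLp.comp_of_map (f := prependDigit i) ?_ (measurable_prependDigit i).aemeasurable
  rw [map_prependDigit_cantorMeasure]
  exact ((Lp.memLp g).restrict _).smul_measure (ENNReal.natCast_ne_top D)

/-- The components are `h i = D^(-1/2) • (g ∘ σᵢ)`; at `x` only the term `i = x 0` is nonzero. This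
yields completeness of the ranges without a formula for the adjoints. -/
theorem exists_eq_sum_monicIsometry (g : Lp ℂ 2 (cantorMeasure D)) :
    ∃ h : Fin D → Lp ℂ 2 (cantorMeasure D), g = ∑ i, monicIsometry i (h i) := by
  classical
  refine ⟨fun i => (memLp_prepend g i).toLp _, Lp.ext ?_⟩
  have h1 : ∀ᵐ x ∂cantorMeasure D, ∀ i : Fin D,
      (monicIsometry i ((memLp_prepend g i).toLp _) : CantorGroup D → ℂ) x =
        standardMonicFun D i x *
          (((Real.sqrt D : ℝ) : ℂ)⁻¹ * g (prependDigit i (cantorShift x))) := by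
    rw [ae_all_iff]
    intro i
    filter_upwards [coeFn_monicLinearMap i ((memLp_prepend g i).toLp _),
      measurePreserving_cantorShift.quasiMeasurePreserving.ae
        (memLp_prepend g i).coeFn_toLp] with x hx hx'
    rw [monicIsometry_apply, hx, hx']
  filter_upwards [h1, Lp.coeFn_finsetSum Finset.univ
    fun i => monicIsometry i ((memLp_prepend g i).toLp _)] with x hx hx'
  rw [hx', Finset.sum_apply, Finset.sum_congr rfl fun i _ => hx i, Finset.sum_eq_single (x 0)]
  · rw [prependDigit_cantorShift, standardMonicFun_eq, if_pos rfl, mul_inv_cancel_left₀]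
    exact Complex.ofReal_ne_zero.2 (Real.sqrt_pos.2 (Nat.cast_pos.2 (NeZero.pos D))).ne'
  · intro i _ hi
    rw [standardMonicFun_eq, if_neg hi.symm]
    simp
  · simp

theorem isCuntzFamily_monicIsometry :
    IsCuntzFamily (monicIsometry : Fin D → _ →L[ℂ] Lp ℂ 2 (cantorMeasure D)) := by
  have h1 : ∀ i j : Fin D, star (monicIsometry j) * monicIsometry i =
      if i = j then (1 : Lp ℂ 2 (cantorMeasure D) →L[ℂ] Lp ℂ 2 (cantorMeasure D)) else 0 := by
    intro i j
    refine ContinuousLinearMap.ext fun f => ext_inner_left ℂ fun g => ?_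
    rw [mul_apply_eq_comp, ContinuousLinearMap.star_eq_adjoint,
      ContinuousLinearMap.adjoint_inner_right, monicIsometry_apply, monicIsometry_apply,
      inner_monicLinearMap]
    by_cases hij : i = j
    · simp [hij]
    · simp [hij, Ne.symm hij]
  refine ⟨h1, ContinuousLinearMap.ext fun g => ?_⟩
  -- Orthogonality of the ranges forces the components to be `h i = Sᵢ* g`, so the decomposition of
  -- `g` is the relation `∑ Sᵢ Sᵢ* = 1` applied to `g`.
  obtain ⟨h, hg⟩ := exists_eq_sum_monicIsometry g
  have h2 : ∀ i, star (monicIsometry i) g = h i := by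
    intro i
    conv_lhs => rw [hg]
    rw [map_sum, Finset.sum_eq_single i]
    · rw [← mul_apply_eq_comp, h1, if_pos rfl]; rfl
    · intro j _ hj
      rw [← mul_apply_eq_comp, h1, if_neg hj]; rfl
    · simp
  rw [sum_apply]
  simp only [mul_apply_eq_comp, h2]
  exact hg.symm

theorem exists_isMonicRep_standard :
    ∃ ρ : CuntzAlgebra D →⋆ₐ[ℂ] (Lp ℂ 2 (cantorMeasure D) →L[ℂ] Lp ℂ 2 (cantorMeasure D)),
      IsMonicRep (cantorMeasure D) (standardMonicFun D) ρ := by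
  obtain ⟨ρ, hρ⟩ := CuntzAlgebra.exists_lift (isCuntzFamily_monicIsometry (D := D))
  refine ⟨ρ, fun i ξ => ?_⟩
  rw [hρ]
  exact coeFn_monicLinearMap i ξ

end MonicRep

/-! ### Abstract self-similar spaces: the coding map is an isomorphism modulo null sets. -/

section DigitCoding

set_option linter.unusedSectionVars false

open Set
open scoped ENNReal

/-- `c : K_D → X` codes the points of the self-similar space `(X, μ)`, whose pieces `T i (X)` all
scale the measure by `D⁻¹`. -/
structure IsDigitCoding {D : ℕ} {X : Type*} [TopologicalSpace X] [MeasurableSpace X]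
    (μ : Measure X) (T : Fin D → X → X) (c : CantorGroup D → X) : Prop where
  continuous_map : ∀ i, Continuous (T i)
  injective_map : ∀ i, Function.Injective (T i)
  continuous : Continuous c
  surjective : Function.Surjective c
  apply_prependDigit : ∀ i ω, c (prependDigit i ω) = T i (c ω)
  measure_image : ∀ i E, μ (T i '' E) = (D : ℝ≥0∞)⁻¹ * μ E

/-- The points with two codings whose first difference is at the `n`-th digit. -/
def overlap {D : ℕ} {X : Type*} (T : Fin D → X → X) : ℕ → Set X
  | 0 => ⋃ (i) (j) (_ : i ≠ j), range (T i) ∩ range (T j)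
  | n + 1 => ⋃ i, T i '' overlap T n

theorem map_mem_overlap {D : ℕ} {X : Type*} {T : Fin D → X → X} (i : Fin D) {p : X}
    (hp : p ∈ ⋃ n, overlap T n) : T i p ∈ ⋃ n, overlap T n := by
  obtain ⟨n, hn⟩ := mem_iUnion.1 hp
  exact mem_iUnion.2 ⟨n + 1, mem_iUnion.2 ⟨i, mem_image_of_mem _ hn⟩⟩

namespace IsDigitCoding

variable {D : ℕ} {X : Type*} [MetricSpace X] [CompactSpace X] [MeasurableSpace X] [BorelSpace X]
  {μ : Measure X} {T : Fin D → X → X} {c : CantorGroup D → X}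

theorem measurableEmbedding (h : IsDigitCoding μ T c) (i : Fin D) : MeasurableEmbedding (T i) :=
  ((h.continuous_map i).isClosedEmbedding (h.injective_map i)).measurableEmbedding

theorem isCompact_overlap (h : IsDigitCoding μ T c) (n : ℕ) : IsCompact (overlap T n) := by
  induction n with
  | zero =>
    refine isCompact_iUnion fun i => isCompact_iUnion fun j => isCompact_iUnion fun _ => ?_
    exact (isCompact_range (h.continuous_map i)).inter (isCompact_range (h.continuous_map j))
  | succ n ih => exact isCompact_iUnion fun i => ih.image (h.continuous_map i)

theorem measurableSet_overlap (h : IsDigitCoding μ T c) : MeasurableSet (⋃ n, overlap T n) :=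
  MeasurableSet.iUnion fun n => (h.isCompact_overlap n).measurableSet

theorem eq_map_cantorShift (h : IsDigitCoding μ T c)
    (ω : CantorGroup D) : c ω = T (ω 0) (c (cantorShift ω)) := by
  rw [← h.apply_prependDigit, prependDigit_cantorShift]

theorem iUnion_range (h : IsDigitCoding μ T c) : ⋃ i, range (T i) = univ := by
  refine eq_univ_of_forall fun p => ?_
  obtain ⟨ω, rfl⟩ := h.surjective p
  rw [h.eq_map_cantorShift]
  exact mem_iUnion.2 ⟨_, mem_range_self _⟩

/-- Strip common initial letters, using injectivity of the maps `T i`, until the codings differ at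
the first letter; the point reached there lies in two different pieces. -/
theorem mem_overlap_of_ne (h : IsDigitCoding μ T c)
    {ω ω' : CantorGroup D} (hω : ω ≠ ω') (heq : c ω = c ω') :
    c ω ∈ ⋃ n, overlap T n := by
  obtain ⟨n, hn⟩ := Function.ne_iff.1 hω
  clear hω
  -- Here `n` is any index of disagreement, not necessarily the first, so the successor case must
  -- still allow the letters at `0` to differ.
  induction n generalizing ω ω' with
  | zero =>
    refine mem_iUnion.2 ⟨0, mem_iUnion₂.2 ⟨ω 0, ω' 0, mem_iUnion.2 ⟨hn, ?_, ?_⟩⟩⟩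
    · rw [h.eq_map_cantorShift ω]
      exact mem_range_self _
    · rw [heq, h.eq_map_cantorShift ω']
      exact mem_range_self _
  | succ n ih =>
    rw [h.eq_map_cantorShift ω]
    by_cases h0 : ω 0 = ω' 0
    · rw [h.eq_map_cantorShift ω, h.eq_map_cantorShift ω', h0] at heq
      obtain ⟨m, hm⟩ := mem_iUnion.1 (ih (h.injective_map _ heq) hn)
      exact mem_iUnion.2 ⟨m + 1, mem_iUnion.2 ⟨ω 0, mem_image_of_mem _ hm⟩⟩
    · refine mem_iUnion.2 ⟨0, mem_iUnion₂.2 ⟨ω 0, ω' 0, mem_iUnion.2 ⟨h0, mem_range_self _, ?_⟩⟩⟩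
      rw [← h.eq_map_cantorShift, heq, h.eq_map_cantorShift]
      exact mem_range_self _

/-- Off the overlaps `c` is injective on a Borel subset of a standard Borel space. By the
Lusin–Souslin theorem it is a measurable embedding there, and its inverse extends measurably to `X`.
-/
theorem exists_measurable_section (h : IsDigitCoding μ T c) [NeZero D] :
    ∃ s : X → CantorGroup D, Measurable s ∧ ∀ ω, c ω ∉ ⋃ n, overlap T n → s (c ω) = ω := by
  have hG : MeasurableSet (c ⁻¹' (⋃ n, overlap T n)ᶜ) :=
    h.measurableSet_overlap.compl.preimage h.continuous.measurable
  have : StandardBorelSpace ↥(c ⁻¹' (⋃ n, overlap T n)ᶜ) := hG.standardBorel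
  have hinj : Function.Injective fun ω : ↥(c ⁻¹' (⋃ n, overlap T n)ᶜ) => c ω := by
    intro ω ω' heq
    by_contra hne
    exact ω.2 (h.mem_overlap_of_ne (fun h' => hne (Subtype.ext h')) heq)
  obtain ⟨s, hs, hsc⟩ := ((h.continuous.measurable.comp
    measurable_subtype_coe).measurableEmbedding hinj).exists_measurable_extend
      measurable_subtype_coe fun _ => ⟨fun _ => (0 : Fin D)⟩
  exact ⟨s, hs, fun ω hω => congrFun hsc ⟨ω, hω⟩⟩

theorem comap_eq (h : IsDigitCoding μ T c) (i : Fin D) : μ.comap (T i) = (D : ℝ≥0∞)⁻¹ • μ := by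
  ext E hE
  rw [(h.measurableEmbedding i).comap_apply, h.measure_image]
  rfl

variable [NeZero D] [IsProbabilityMeasure μ]

/-- A space of mass `1` covered by `D` pieces of mass `1 / D` leaves no mass for overlaps. -/
theorem measure_range_inter (h : IsDigitCoding μ T c)
    {i j : Fin D} (hij : i ≠ j) : μ (range (T i) ∩ range (T j)) = 0 := by
  classical
  have hr : ∀ k, μ (range (T k)) = (D : ℝ≥0∞)⁻¹ := fun k => by
    rw [← image_univ, h.measure_image, measure_univ, mul_one]
  have hm : MeasurableSet (range (T j)) := (h.measurableEmbedding j).measurableSet_range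
  -- Removing `range (T j)` from the `i`-th piece still leaves a cover, since `j ≠ i` remains among
  -- the other pieces.
  have h1 : (1 : ℝ≥0∞) ≤ μ (range (T i) \ range (T j)) +
      ∑ k ∈ Finset.univ.erase i, μ (range (T k)) := by
    rw [← measure_univ (μ := μ)]
    refine (measure_mono ?_).trans ((measure_union_le _ _).trans
      (add_le_add_right (measure_biUnion_finset_le _ _) _))
    rw [← h.iUnion_range]
    refine iUnion_subset fun k p hp => ?_
    by_cases hk : k = i
    · subst hk
      by_cases hpj : p ∈ range (T j)
      · exact Or.inr (mem_iUnion₂.2 ⟨j, by simp [hij.symm], hpj⟩)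
      · exact Or.inl ⟨hp, hpj⟩
    · exact Or.inr (mem_iUnion₂.2 ⟨k, by simp [hk], hp⟩)
  have h2 : μ (range (T i) ∩ range (T j)) + 1 ≤ 1 := by
    calc μ (range (T i) ∩ range (T j)) + 1
        ≤ μ (range (T i) ∩ range (T j)) + (μ (range (T i) \ range (T j)) +
          ∑ k ∈ Finset.univ.erase i, μ (range (T k))) := by gcongr
      _ = ∑ k, μ (range (T k)) := by
        rw [← add_assoc, measure_inter_add_sdiff _ hm,
          Finset.add_sum_erase _ (fun k => μ (range (T k))) (Finset.mem_univ i)]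
      _ = 1 := by
        simp only [hr, Finset.sum_const, Finset.card_univ, Fintype.card_fin, nsmul_eq_mul]
        rw [mul_comm, natCast_inv_mul_cancel]
  simpa using ENNReal.le_sub_of_add_le_right ENNReal.one_ne_top h2

theorem measure_overlap (h : IsDigitCoding μ T c) : μ (⋃ n, overlap T n) = 0 := by
  refine measure_iUnion_null fun n => ?_
  induction n with
  | zero =>
    exact measure_iUnion_null fun i => measure_iUnion_null fun j => measure_iUnion_null fun hij =>
      h.measure_range_inter hij
  | succ n ih =>
    refine measure_iUnion_null fun i => ?_
    rw [h.measure_image, ih, mul_zero]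

theorem ae_notMem_overlap (h : IsDigitCoding μ T c) : ∀ᵐ p ∂μ, p ∉ ⋃ n, overlap T n :=
  measure_eq_zero_iff_ae_notMem.1 h.measure_overlap

theorem quasiMeasurePreserving_map (h : IsDigitCoding μ T c)
    (i : Fin D) : Measure.QuasiMeasurePreserving (T i) μ μ := by
  refine ⟨(h.continuous_map i).measurable, Measure.AbsolutelyContinuous.mk fun E hE h0 => ?_⟩
  rw [Measure.map_apply (h.continuous_map i).measurable hE]
  have h1 : μ (T i '' (T i ⁻¹' E)) = 0 := measure_mono_null (image_preimage_subset _ _) h0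
  rw [h.measure_image] at h1
  exact (mul_eq_zero.1 h1).resolve_left (ENNReal.inv_ne_zero.2 (ENNReal.natCast_ne_top D))

theorem average_map (h : IsDigitCoding μ T c) :
    (D : ℝ≥0∞)⁻¹ • ∑ i : Fin D, μ.map (T i) = μ := by
  ext E hE
  rw [Measure.smul_apply, Measure.finsetSum_apply, smul_eq_mul, Finset.mul_sum]
  have h1 : ∀ i, (D : ℝ≥0∞)⁻¹ * μ.map (T i) E = μ (E ∩ range (T i)) := fun i => by
    rw [Measure.map_apply (h.continuous_map i).measurable hE, ← h.measure_image,
      image_preimage_eq_inter_range]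
  rw [Finset.sum_congr rfl fun i _ => h1 i, ← tsum_fintype (L := .unconditional _),
    ← measure_iUnion₀, ← inter_iUnion, h.iUnion_range, inter_univ]
  · intro i j hij
    exact measure_mono_null (inter_subset_inter inter_subset_right inter_subset_right)
      (h.measure_range_inter hij)
  · exact fun i => (hE.inter (h.measurableEmbedding i).measurableSet_range).nullMeasurableSet

/-- Almost everywhere `s` intertwines `T i` with `σᵢ`. Hence the self-similarity of `μ` passes to
its image under `s`, which must then be `ν_D`. -/
theorem measurePreserving_section (h : IsDigitCoding μ T c)
    {s : X → CantorGroup D} (hs : Measurable s)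
    (hsc : ∀ ω, c ω ∉ ⋃ n, overlap T n → s (c ω) = ω) :
    MeasurePreserving s μ (cantorMeasure D) := by
  refine ⟨hs, ?_⟩
  have : IsProbabilityMeasure (μ.map s) := Measure.isProbabilityMeasure_map hs.aemeasurable
  refine IsDigitInvariant.eq_cantorMeasure ?_
  have h1 : ∀ i, (μ.map s).map (prependDigit i) = (μ.map (T i)).map s := fun i => by
    rw [Measure.map_map (measurable_prependDigit i) hs,
      Measure.map_map hs (h.continuous_map i).measurable]
    refine Measure.map_congr ?_
    -- Asking that `T i p` avoid the overlaps is enough, since `T i` maps overlaps into overlaps and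
    -- so `p` avoids them too.
    filter_upwards [(h.quasiMeasurePreserving_map i).ae h.ae_notMem_overlap] with p hp
    obtain ⟨ω, rfl⟩ := h.surjective p
    have hω : c ω ∉ ⋃ n, overlap T n := fun h' => hp (map_mem_overlap i h')
    rw [Function.comp_apply, Function.comp_apply, hsc ω hω, ← h.apply_prependDigit, hsc]
    rwa [h.apply_prependDigit]
  rw [IsDigitInvariant, Finset.sum_congr rfl fun i _ => h1 i]
  conv_rhs => rw [← h.average_map]
  rw [Measure.map_smul, ← Measure.mapₗ_apply_of_measurable hs, map_sum]
  simp only [Measure.mapₗ_apply_of_measurable hs]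

theorem section_ae (h : IsDigitCoding μ T c) {s : X → CantorGroup D}
    (hsc : ∀ ω, c ω ∉ ⋃ n, overlap T n → s (c ω) = ω) : ∀ᵐ p ∂μ, c (s p) = p := by
  filter_upwards [h.ae_notMem_overlap] with p hp
  obtain ⟨ω, rfl⟩ := h.surjective p
  rw [hsc ω hp]

/-- Since `ν_D` is the image of `μ` under `s`, its image under `c` is that of `μ` under `c ∘ s`,
which is the identity almost everywhere. -/
theorem measurePreserving (h : IsDigitCoding μ T c) : MeasurePreserving c (cantorMeasure D) μ := by
  obtain ⟨s, hs, hsc⟩ := h.exists_measurable_section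
  refine ⟨h.continuous.measurable, ?_⟩
  rw [← (h.measurePreserving_section hs hsc).map_eq, Measure.map_map h.continuous.measurable hs,
    Measure.map_congr (f := c ∘ s) (g := id) (h.section_ae hsc), Measure.map_id]

theorem ae_section (h : IsDigitCoding μ T c) {s : X → CantorGroup D}
    (hsc : ∀ ω, c ω ∉ ⋃ n, overlap T n → s (c ω) = ω) : ∀ᵐ ω ∂cantorMeasure D, s (c ω) = ω := by
  filter_upwards [h.measurePreserving.quasiMeasurePreserving.ae h.ae_notMem_overlap] with ω hω
  exact hsc ω hω

/-- Composition with the coding map is surjective on `L²`. -/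
theorem surjective_compMeasurePreserving (h : IsDigitCoding μ T c) :
    Function.Surjective (Lp.compMeasurePreservingₗᵢ ℂ c h.measurePreserving :
      Lp ℂ 2 μ →ₗᵢ[ℂ] Lp ℂ 2 (cantorMeasure D)) := by
  obtain ⟨s, hs, hsc⟩ := h.exists_measurable_section
  have hms := h.measurePreserving_section hs hsc
  intro f
  refine ⟨Lp.compMeasurePreserving s hms f, Lp.ext ?_⟩
  filter_upwards [Lp.coeFn_compMeasurePreserving (Lp.compMeasurePreserving s hms f)
    h.measurePreserving, h.measurePreserving.quasiMeasurePreserving.ae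
    (Lp.coeFn_compMeasurePreserving f hms), h.ae_section hsc] with ω h1 h2 h3
  refine h1.trans ?_
  rw [Function.comp_apply, h2, Function.comp_apply, h3]

/-- The unitary `ξ ↦ ξ ∘ c`. -/
noncomputable def unitary (h : IsDigitCoding μ T c) : Lp ℂ 2 μ ≃ₗᵢ[ℂ] Lp ℂ 2 (cantorMeasure D) :=
  LinearIsometryEquiv.ofSurjective (Lp.compMeasurePreservingₗᵢ ℂ c h.measurePreserving)
    h.surjective_compMeasurePreserving

theorem coeFn_unitary (h : IsDigitCoding μ T c)
    (ξ : Lp ℂ 2 μ) : h.unitary ξ =ᵐ[cantorMeasure D] ξ ∘ c :=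
  Lp.coeFn_compMeasurePreserving ξ h.measurePreserving

end IsDigitCoding

end DigitCoding

/-! ### The semibranching representation and its transport to the Cantor group. -/

section CodingMap

set_option linter.unusedSectionVars false

open Set
open scoped ENNReal

namespace IsDigitCoding

variable {D : ℕ} [NeZero D] {X : Type} [MetricSpace X] [CompactSpace X] [MeasurableSpace X]
  [BorelSpace X] {μ : Measure X} [IsProbabilityMeasure μ] {T : Fin D → X → X}
  {c : CantorGroup D → X} {τ : X → X}

/-- Whatever expansion `τ` selects at each point, there is only one choice off the overlaps. -/
theorem coding_apply (h : IsDigitCoding μ T c)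
    (hτ : ∀ p, ∃ ω, p = c ω ∧ τ p = c (cantorShift ω))
    {ω : CantorGroup D} (hω : c ω ∉ ⋃ n, overlap T n) :
    τ (c ω) = c (cantorShift ω) := by
  obtain ⟨ω', h1, h2⟩ := hτ (c ω)
  by_cases hne : ω = ω'
  · rw [h2, ← hne]
  · exact absurd (h.mem_overlap_of_ne hne h1) hω

theorem rnDeriv_comap (h : IsDigitCoding μ T c) (i : Fin D) :
    (μ.comap (T i)).rnDeriv μ =ᵐ[μ] fun _ => (D : ℝ≥0∞)⁻¹ := by
  rw [h.comap_eq]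
  have h1 := Measure.rnDeriv_smul_left_of_ne_top μ μ (r := (D : ℝ≥0∞)⁻¹)
    (ENNReal.inv_ne_top.2 (by simp [NeZero.ne D]))
  filter_upwards [h1, Measure.rnDeriv_self μ] with x hx hx'
  rw [hx, Pi.smul_apply, hx', smul_eq_mul, mul_one]

theorem isSemibranchingSystem (h : IsDigitCoding μ T c)
    (hτ : ∀ p, ∃ ω, p = c ω ∧ τ p = c (cantorShift ω)) : IsSemibranchingSystem μ T τ where
  measurable i := (h.continuous_map i).measurable
  compl_range_null := by rw [h.iUnion_range, compl_univ, measure_empty]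
  range_inter_null _ _ hij := h.measure_range_inter hij
  absolutelyContinuous i := by
    rw [h.comap_eq]
    exact Measure.smul_absolutelyContinuous
  rnDeriv_pos i := by
    filter_upwards [h.rnDeriv_comap i] with x hx
    rw [hx]
    exact ENNReal.inv_pos.2 (ENNReal.natCast_ne_top D)
  coding_comp i := by
    filter_upwards [(h.quasiMeasurePreserving_map i).ae h.ae_notMem_overlap] with p hp
    obtain ⟨ω, rfl⟩ := h.surjective p
    rw [← h.apply_prependDigit] at hp ⊢
    rw [h.coding_apply hτ hp, cantorShift_prependDigit]

theorem mem_range_map_iff (h : IsDigitCoding μ T c)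
    {ω : CantorGroup D} (hω : c ω ∉ ⋃ n, overlap T n) (i : Fin D) :
    c ω ∈ range (T i) ↔ ω 0 = i := by
  constructor
  · rintro ⟨q, hq⟩
    obtain ⟨η, rfl⟩ := h.surjective q
    rw [← h.apply_prependDigit] at hq
    by_contra hne
    refine hω (h.mem_overlap_of_ne (ω' := prependDigit i η) (fun h' => hne ?_) hq.symm)
    rw [h']
    rfl
  · rintro rfl
    rw [h.eq_map_cantorShift]
    exact mem_range_self _

/-- Pulled back along the coding map, the semibranching operators become the monic ones. -/
theorem semibranching_comp_ae (h : IsDigitCoding μ T c)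
    (hτ : ∀ p, ∃ ω, p = c ω ∧ τ p = c (cantorShift ω))
    (i : Fin D) (ξ : X → ℂ) :
    ((range (T i)).indicator fun x =>
        ((((μ.comap (T i)).rnDeriv μ (τ x)).toReal ^ (-(1 / 2) : ℝ) : ℝ) : ℂ) * ξ (τ x)) ∘ c
      =ᵐ[cantorMeasure D]
      fun ω => (standardMonicFun D i ω : ℂ) * ξ (c (cantorShift ω)) := by
  classical
  -- The derivative is evaluated at `c (cantorShift ω)`, so its almost everywhere value is pulled
  -- back along `c ∘ cantorShift`, which also preserves measure.
  filter_upwards [h.measurePreserving.quasiMeasurePreserving.ae h.ae_notMem_overlap,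
    (h.measurePreserving.comp measurePreserving_cantorShift).quasiMeasurePreserving.ae
      (h.rnDeriv_comap i)] with ω h1 h2
  rw [Function.comp_apply, indicator_apply, h.coding_apply hτ h1, standardMonicFun_eq,
    ← Function.comp_apply (f := c) (g := cantorShift), h2]
  simp only [h.mem_range_map_iff h1]
  split_ifs
  · rw [ENNReal.toReal_inv, ENNReal.toReal_natCast, Real.inv_rpow (Nat.cast_nonneg D),
      Real.rpow_neg (Nat.cast_nonneg D), inv_inv, ← Real.sqrt_eq_rpow]
  · simp

theorem unitary_semibranching (h : IsDigitCoding μ T c)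
    (hτ : ∀ p, ∃ ω, p = c ω ∧ τ p = c (cantorShift ω))
    {π : CuntzAlgebra D →⋆ₐ[ℂ] (Lp ℂ 2 μ →L[ℂ] Lp ℂ 2 μ)}
    {ρ : CuntzAlgebra D →⋆ₐ[ℂ] (Lp ℂ 2 (cantorMeasure D) →L[ℂ] Lp ℂ 2 (cantorMeasure D))}
    (hπ : IsSemibranchingRep μ T τ π) (hρ : IsMonicRep (cantorMeasure D) (standardMonicFun D) ρ)
    (i : Fin D) (ξ : Lp ℂ 2 μ) :
    h.unitary (π (CuntzAlgebra.gen i) ξ) = ρ (CuntzAlgebra.gen i) (h.unitary ξ) := by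
  refine Lp.ext ?_
  filter_upwards [h.coeFn_unitary (π (CuntzAlgebra.gen i) ξ), hρ i (h.unitary ξ),
    measurePreserving_cantorShift.quasiMeasurePreserving.ae (h.coeFn_unitary ξ),
    h.measurePreserving.quasiMeasurePreserving.ae (hπ i ξ),
    h.semibranching_comp_ae hτ i ξ] with ω h1 h2 h3 h4 h5
  rw [h1, h2, h3, Function.comp_apply, h4]
  exact h5

theorem isSemibranchingRep_of_unitary (h : IsDigitCoding μ T c)
    (hτ : ∀ p, ∃ ω, p = c ω ∧ τ p = c (cantorShift ω))
    {π : CuntzAlgebra D →⋆ₐ[ℂ] (Lp ℂ 2 μ →L[ℂ] Lp ℂ 2 μ)}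
    {ρ : CuntzAlgebra D →⋆ₐ[ℂ] (Lp ℂ 2 (cantorMeasure D) →L[ℂ] Lp ℂ 2 (cantorMeasure D))}
    (hρ : IsMonicRep (cantorMeasure D) (standardMonicFun D) ρ)
    (hU : ∀ i ξ, h.unitary (π (CuntzAlgebra.gen i) ξ) = ρ (CuntzAlgebra.gen i) (h.unitary ξ)) :
    IsSemibranchingRep μ T τ π := by
  intro i ξ
  obtain ⟨s, hs, hsc⟩ := h.exists_measurable_section
  have hms := (h.measurePreserving_section hs hsc).quasiMeasurePreserving
  -- Equal classes in `L²` have the same chosen representative, so this identity holds at every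
  -- point, in particular at `s p`.
  have h0 := congrArg (fun f : Lp ℂ 2 (cantorMeasure D) => (f : CantorGroup D → ℂ)) (hU i ξ)
  filter_upwards [h.section_ae hsc, hms.ae (h.coeFn_unitary (π (CuntzAlgebra.gen i) ξ)),
    hms.ae (hρ i (h.unitary ξ)),
    hms.ae (measurePreserving_cantorShift.quasiMeasurePreserving.ae (h.coeFn_unitary ξ)),
    hms.ae (h.semibranching_comp_ae hτ i ξ)] with p h1 h2 h3 h4 h5
  rw [Function.comp_apply, h1] at h2 h5
  rw [← h2, congrFun h0 (s p), h3, h4, h5]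
  rfl

/-- Conjugating the monic representation by the unitary makes a separate check of the Cuntz
relations on `L²(X, μ)` unnecessary. -/
theorem exists_isSemibranchingRep (h : IsDigitCoding μ T c)
    (hτ : ∀ p, ∃ ω, p = c ω ∧ τ p = c (cantorShift ω)) :
    ∃ π : CuntzAlgebra D →⋆ₐ[ℂ] (Lp ℂ 2 μ →L[ℂ] Lp ℂ 2 μ), IsSemibranchingRep μ T τ π := by
  obtain ⟨ρ, hρ⟩ := exists_isMonicRep_standard (D := D)
  refine ⟨(h.unitary.symm.conjStarAlgEquiv :
    _ →⋆ₐ[ℂ] (Lp ℂ 2 μ →L[ℂ] Lp ℂ 2 μ)).comp ρ, h.isSemibranchingRep_of_unitary hτ hρ fun i ξ => ?_⟩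
  exact h.unitary.apply_symm_apply _

theorem unitarilyEquivalent (h : IsDigitCoding μ T c)
    (hτ : ∀ p, ∃ ω, p = c ω ∧ τ p = c (cantorShift ω))
    {π : CuntzAlgebra D →⋆ₐ[ℂ] (Lp ℂ 2 μ →L[ℂ] Lp ℂ 2 μ)}
    {ρ : CuntzAlgebra D →⋆ₐ[ℂ] (Lp ℂ 2 (cantorMeasure D) →L[ℂ] Lp ℂ 2 (cantorMeasure D))}
    (hπ : IsSemibranchingRep μ T τ π)
    (hρ : IsMonicRep (cantorMeasure D) (standardMonicFun D) ρ) : UnitarilyEquivalent π ρ := by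
  have h1 : (h.unitary.conjStarAlgEquiv : _ →⋆ₐ[ℂ] _).comp π = ρ := by
    refine CuntzAlgebra.hom_ext fun i => ContinuousLinearMap.ext fun f => ?_
    change h.unitary (π (CuntzAlgebra.gen i) (h.unitary.symm f)) = _
    rw [h.unitary_semibranching hτ hπ hρ, h.unitary.apply_symm_apply]
  refine ⟨h.unitary, fun a ξ => ?_⟩
  rw [← h1]
  change _ = h.unitary (π a (h.unitary.symm (h.unitary ξ)))
  rw [h.unitary.symm_apply_apply]

end IsDigitCoding

end CodingMap

/-! ### Leading digits and the mass of grid cells. -/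

section LeadingDigits

open Set
open scoped ENNReal

variable {N D : ℕ}

/-- The integer whose `N`-adic digits are the first `k` terms of `x ∘ ω`. -/
def leadingNum (x : Fin D → Fin N) : ℕ → CantorGroup D → ℕ
  | 0, _ => 0
  | k + 1, ω => x (ω 0) * N ^ k + leadingNum x k (cantorShift ω)

theorem leadingNum_lt (x : Fin D → Fin N) (k : ℕ) (ω : CantorGroup D) :
    leadingNum x k ω < N ^ k := by
  induction k generalizing ω with
  | zero => simp [leadingNum]
  | succ k ih =>
    have h1 := ih (cantorShift ω)
    have h2 : ((x (ω 0) : ℕ) + 1) * N ^ k ≤ N * N ^ k := Nat.mul_le_mul_right _ (x (ω 0)).2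
    rw [leadingNum, pow_succ']
    linarith

theorem measurable_leadingNum (x : Fin D → Fin N) (k : ℕ) :
    Measurable (leadingNum x k) := by
  induction k with
  | zero => exact measurable_const
  | succ k ih =>
    have h1 : Measurable fun ω : CantorGroup D => (x (ω 0) : ℕ) * N ^ k :=
      (Measurable.of_discrete (f := fun j : Fin D => (x j : ℕ) * N ^ k)).comp
        (measurable_pi_apply 0)
    exact h1.add (ih.comp measurable_cantorShift)

theorem ofDigits_cantorShift (x : Fin D → Fin N) (ω : CantorGroup D) :
    Real.ofDigits (fun i => x (ω i)) =
      (x (ω 0) : ℝ) / N + Real.ofDigits (fun i => x (cantorShift ω i)) / N := by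
  rw [Real.ofDigits_eq_sum_add_ofDigits _ 1]
  simp only [Finset.sum_range_one, Real.ofDigitsTerm, zero_add, pow_one, ← div_eq_mul_inv,
    inv_mul_eq_div]
  rfl

/-- After scaling by `N ^ k` the remaining tail is a number in `[0, 1]`. Both bounds are weak
because a tail of digits `N - 1` equals `1`. -/
theorem leadingNum_le_and_le (hN : 0 < N) (x : Fin D → Fin N) (k : ℕ) (ω : CantorGroup D) :
    (leadingNum x k ω : ℝ) ≤ N ^ k * Real.ofDigits (fun i => x (ω i)) ∧
      N ^ k * Real.ofDigits (fun i => x (ω i)) ≤ leadingNum x k ω + 1 := by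
  induction k generalizing ω with
  | zero =>
    simpa [leadingNum] using
      And.intro (Real.ofDigits_nonneg fun i => x (ω i)) (Real.ofDigits_le_one fun i => x (ω i))
  | succ k ih =>
    have hN' : (N : ℝ) ≠ 0 := Nat.cast_ne_zero.2 hN.ne'
    have h1 : (N : ℝ) ^ (k + 1) * Real.ofDigits (fun i => x (ω i)) =
        x (ω 0) * N ^ k + N ^ k * Real.ofDigits (fun i => x (cantorShift ω i)) := by
      rw [ofDigits_cantorShift, pow_succ]
      field_simp
    obtain ⟨h2, h3⟩ := ih (cantorShift ω)
    rw [h1, leadingNum]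
    push_cast
    constructor <;> linarith

/-- The two integers determine the first `k` digit pairs, hence the first `k` letters, because
distinct letters have distinct digit pairs. Each letter costs a factor `1 / D`. -/
theorem cantorMeasure_leadingNum_le [NeZero D] (hN : 0 < N) {x y : Fin D → Fin N}
    (hxy : Function.Injective fun j => (x j, y j)) (k m n : ℕ) :
    cantorMeasure D {ω | leadingNum x k ω = m ∧ leadingNum y k ω = n} ≤ (D : ℝ≥0∞)⁻¹ ^ k := by
  induction k generalizing m n with
  | zero => simpa using prob_le_one
  | succ k ih =>
    have hE : MeasurableSet {ω : CantorGroup D | leadingNum x (k + 1) ω = m ∧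
        leadingNum y (k + 1) ω = n} :=
      (measurable_leadingNum x (k + 1) (measurableSet_singleton m)).inter
        (measurable_leadingNum y (k + 1) (measurableSet_singleton n))
    rw [cantorMeasure_apply hE, pow_succ']
    refine mul_le_mul_right ?_ _
    -- The lower digits form an integer below `N ^ k`, so division by `N ^ k` recovers the first
    -- digit.
    have key : ∀ (z : Fin D → Fin N) (l : ℕ) (j : Fin D) (ω : CantorGroup D),
        leadingNum z (k + 1) (prependDigit j ω) = l → (z j : ℕ) = l / N ^ k := by
      intro z l j ω hl
      rw [← hl, leadingNum, cantorShift_prependDigit, add_comm,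
        Nat.add_mul_div_right _ _ (by positivity), Nat.div_eq_of_lt (leadingNum_lt z k ω), zero_add]
      rfl
    by_cases hj : ∃ j : Fin D, (x j : ℕ) = m / N ^ k ∧ (y j : ℕ) = n / N ^ k
    · obtain ⟨j, hjx, hjy⟩ := hj
      rw [Finset.sum_eq_single j]
      · refine (measure_mono ?_).trans (ih (m - x j * N ^ k) (n - y j * N ^ k))
        rintro ω ⟨h1, h2⟩
        exact ⟨(Nat.sub_eq_of_eq_add' h1.symm).symm, (Nat.sub_eq_of_eq_add' h2.symm).symm⟩
      · intro i _ hij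
        convert measure_empty (μ := cantorMeasure D)
        rw [eq_empty_iff_forall_notMem]
        rintro ω ⟨h1, h2⟩
        refine hij (hxy (Prod.ext (Fin.ext ?_) (Fin.ext ?_)))
        · exact (key x m i ω h1).trans hjx.symm
        · exact (key y n i ω h2).trans hjy.symm
      · simp
    · rw [Finset.sum_eq_zero]
      · exact zero_le
      · intro i _
        convert measure_empty (μ := cantorMeasure D)
        rw [eq_empty_iff_forall_notMem]
        rintro ω ⟨h1, h2⟩
        exact hj ⟨i, key x m i ω h1, key y n i ω h2⟩

end LeadingDigits

/-! ### The coding map of the Sierpinski fractal. -/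

section SierpinskiCoding

open Set
open scoped ENNReal

variable {N D : ℕ} {A : Matrix (Fin N) (Fin N) ℕ}

def rowDigit (e : Fin D ≃o OneEntry A) (j : Fin D) : Fin N := (ofLex (e j).1).1

def colDigit (e : Fin D ≃o OneEntry A) (j : Fin D) : Fin N := (ofLex (e j).1).2

theorem injective_rowDigit_colDigit (e : Fin D ≃o OneEntry A) :
    Function.Injective fun j => (rowDigit e j, colDigit e j) :=
  fun _ _ hij => e.injective (Subtype.ext (ofLex.injective hij))

/-- The point of `𝕊_A` whose successive digits are the positions numbered `ω₁, ω₂, …`. -/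
noncomputable def sierpinskiPoint (e : Fin D ≃o OneEntry A) (ω : CantorGroup D) :
    sierpinskiSet A :=
  ⟨nadicPoint (fun i => rowDigit e (ω i)) fun i => colDigit e (ω i), _, _,
    fun i => (e (ω i)).2, rfl⟩

theorem nadicPoint_eq_ofDigits (x y : ℕ → Fin N) :
    nadicPoint x y = !₂[Real.ofDigits x, Real.ofDigits y] := by
  simp only [nadicPoint, Real.ofDigits, Real.ofDigitsTerm, div_eq_mul_inv]

theorem sierpinskiPoint_prependDigit (e : Fin D ≃o OneEntry A) (j : Fin D) (ω : CantorGroup D) :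
    sierpinskiPoint e (prependDigit j ω) = sierpinskiMap A (e j) (sierpinskiPoint e ω) := by
  refine Subtype.ext ?_
  have h : ∀ z : Fin D → Fin N, Real.ofDigits (fun i => z (prependDigit j ω i)) =
      Real.ofDigits (fun i => z (ω i)) / N + (z j : ℝ) / N := fun z => by
    rw [ofDigits_cantorShift, cantorShift_prependDigit, add_comm]
    rfl
  simp only [sierpinskiPoint, sierpinskiMap, nadicPoint_eq_ofDigits, h]
  rfl

theorem surjective_sierpinskiPoint (e : Fin D ≃o OneEntry A) :
    Function.Surjective (sierpinskiPoint e) := by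
  rintro ⟨p, x, y, hxy, rfl⟩
  refine ⟨fun i => e.symm ⟨toLex (x i, y i), hxy i⟩, Subtype.ext ?_⟩
  simp [sierpinskiPoint, rowDigit, colDigit]

theorem continuous_sierpinskiPoint (e : Fin D ≃o OneEntry A) :
    Continuous (sierpinskiPoint e) := by
  have h : ∀ z : Fin D → Fin N, Continuous fun ω : CantorGroup D =>
      Real.ofDigits fun i => z (ω i) := fun z =>
    Real.continuous_ofDigits.comp (continuous_pi fun i =>
      (continuous_of_discreteTopology (f := z)).comp (continuous_apply i))
  refine Continuous.subtype_mk ?_ _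
  simp only [nadicPoint_eq_ofDigits]
  refine (PiLp.continuous_toLp 2 _).comp (continuous_pi fun i => ?_)
  fin_cases i
  · exact h (rowDigit e)
  · exact h (colDigit e)

theorem compactSpace_sierpinskiSet (e : Fin D ≃o OneEntry A) : CompactSpace (sierpinskiSet A) := by
  rw [← isCompact_univ_iff, ← (surjective_sierpinskiPoint e).range_eq]
  exact isCompact_range (continuous_sierpinskiPoint e)

theorem dist_sierpinskiMap (c : OneEntry A) (p q : sierpinskiSet A) :
    dist (sierpinskiMap A c p) (sierpinskiMap A c q) = (N : ℝ)⁻¹ * dist p q := by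
  have h : (sierpinskiMap A c p).1 - (sierpinskiMap A c q).1 = (N : ℝ)⁻¹ • (p.1 - q.1) := by
    ext i
    fin_cases i <;> simp [sierpinskiMap] <;> ring
  rw [Subtype.dist_eq, Subtype.dist_eq, dist_eq_norm, dist_eq_norm, h, norm_smul, norm_inv,
    Real.norm_natCast]

theorem lipschitzWith_sierpinskiMap (c : OneEntry A) :
    LipschitzWith (N : NNReal)⁻¹ (sierpinskiMap A c) :=
  LipschitzWith.of_dist_le_mul fun p q => by
    rw [dist_sierpinskiMap]
    simp

theorem antilipschitzWith_sierpinskiMap (hN : 0 < N) (c : OneEntry A) :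
    AntilipschitzWith N (sierpinskiMap A c) :=
  AntilipschitzWith.of_le_mul_dist fun p q => by
    rw [dist_sierpinskiMap, NNReal.coe_natCast,
      mul_inv_cancel_left₀ (Nat.cast_ne_zero.2 hN.ne')]

/-- Each common letter contracts by `1 / N`; the constant `2` is a crude bound for the diameter `√2`
of the unit square. -/
theorem dist_sierpinskiPoint_le (hN : 0 < N) (e : Fin D ≃o OneEntry A) (k : ℕ)
    {ω ω' : CantorGroup D} (h : ∀ i < k, ω i = ω' i) :
    dist (sierpinskiPoint e ω) (sierpinskiPoint e ω') ≤ 2 * (N : ℝ)⁻¹ ^ k := by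
  induction k generalizing ω ω' with
  | zero =>
    have hz : ∀ z : Fin D → Fin N, dist (Real.ofDigits fun i => z (ω i))
        (Real.ofDigits fun i => z (ω' i)) ^ 2 ≤ 1 := fun z => by
      rw [Real.dist_eq, sq_abs]
      have h1 := Real.ofDigits_nonneg fun i => z (ω i)
      have h2 := Real.ofDigits_nonneg fun i => z (ω' i)
      have h3 := Real.ofDigits_le_one fun i => z (ω i)
      have h4 := Real.ofDigits_le_one fun i => z (ω' i)
      nlinarith
    rw [Subtype.dist_eq, EuclideanSpace.dist_eq, pow_zero, mul_one]
    refine Real.sqrt_le_iff.2 ⟨by norm_num, ?_⟩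
    rw [Fin.sum_univ_two]
    have h1 := hz (rowDigit e)
    have h2 := hz (colDigit e)
    simp only [sierpinskiPoint, nadicPoint_eq_ofDigits]
    refine (add_le_add h1 h2).trans (by norm_num)
  | succ k ih =>
    have h1 := ih (ω := cantorShift ω) (ω' := cantorShift ω') fun i hi => h (i + 1) (by omega)
    rw [← prependDigit_cantorShift ω, ← prependDigit_cantorShift ω', h 0 (by omega),
      sierpinskiPoint_prependDigit, sierpinskiPoint_prependDigit, dist_sierpinskiMap, pow_succ']
    calc _ ≤ (N : ℝ)⁻¹ * (2 * (N : ℝ)⁻¹ ^ k) := by gcongr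
      _ = _ := by ring

/-- Subtracting the first digit and multiplying by `N` shifts an expansion, so `τ` is the shift of
the expansion that it selects. -/
theorem exists_sierpinskiPoint_of_coding (hN : 0 < N) (e : Fin D ≃o OneEntry A)
    {τ : sierpinskiSet A → sierpinskiSet A} (hτ : IsSierpinskiCoding A τ) (p : sierpinskiSet A) :
    ∃ ω, p = sierpinskiPoint e ω ∧ τ p = sierpinskiPoint e (cantorShift ω) := by
  obtain ⟨x, y, hxy, hp, hτp⟩ := hτ p
  have hN' : (N : ℝ) ≠ 0 := Nat.cast_ne_zero.2 hN.ne'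
  have hpω : p = sierpinskiPoint e fun i => e.symm ⟨toLex (x i, y i), hxy i⟩ :=
    Subtype.ext (by simp [hp, sierpinskiPoint, rowDigit, colDigit])
  refine ⟨_, hpω, Subtype.ext ?_⟩
  have h : ∀ (z : ℕ → Fin N), (N : ℝ) * (Real.ofDigits z - (z 0 : ℝ) / N) =
      Real.ofDigits fun i => z (i + 1) := fun z => by
    rw [Real.ofDigits_eq_sum_add_ofDigits z 1]
    simp only [Finset.sum_range_one, Real.ofDigitsTerm, zero_add, pow_one]
    field_simp
    ring
  rw [hτp, hp]
  simp only [nadicPoint_eq_ofDigits, sierpinskiPoint]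
  simp [h, rowDigit, colDigit, cantorShift]

end SierpinskiCoding

/-! ### Scaling, finiteness and positivity of the Hausdorff measure. -/

section SierpinskiMeasure

open Set Filter Topology
open scoped ENNReal

variable {N D : ℕ} {A : Matrix (Fin N) (Fin N) ℕ}

theorem card_oneEntry (e : Fin D ≃o OneEntry A) : Nat.card (OneEntry A) = D := by
  rw [← Nat.card_congr e.toEquiv, Nat.card_eq_fintype_card, Fintype.card_fin]

theorem sierpinskiHausdorff_eq (e : Fin D ≃o OneEntry A) :
    sierpinskiHausdorff A = Measure.hausdorffMeasure (Real.log D / Real.log N) := by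
  rw [sierpinskiHausdorff, card_oneEntry e]

theorem similarityDim_pos (hN : 2 ≤ N) (hD : 1 < D) : 0 < Real.log D / Real.log N :=
  div_pos (Real.log_pos (by exact_mod_cast hD)) (Real.log_pos (by exact_mod_cast hN))

theorem natCast_rpow_similarityDim (hN : 2 ≤ N) (hD : 1 < D) :
    (N : ℝ≥0∞) ^ (Real.log D / Real.log N) = D := by
  have hN1 : (1 : ℝ) < N := by exact_mod_cast hN
  have hD0 : (0 : ℝ) < D := by exact_mod_cast (zero_lt_one.trans hD)
  rw [← ENNReal.ofReal_natCast N, ENNReal.ofReal_rpow_of_pos (zero_lt_one.trans hN1),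
    ← Real.logb, Real.rpow_logb (zero_lt_one.trans hN1) hN1.ne' hD0, ENNReal.ofReal_natCast]

theorem inv_pow_rpow_similarityDim (hN : 2 ≤ N) (hD : 1 < D) (k : ℕ) :
    ((N : ℝ≥0∞)⁻¹ ^ k) ^ (Real.log D / Real.log N) = (D : ℝ≥0∞)⁻¹ ^ k := by
  rw [← ENNReal.rpow_natCast, ← ENNReal.rpow_mul, mul_comm, ENNReal.rpow_mul,
    ENNReal.inv_rpow, natCast_rpow_similarityDim hN hD, ENNReal.rpow_natCast]

/-- The Lipschitz and antilipschitz constants of a similarity are reciprocal, so the two Hausdorff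
estimates meet at `N ^ s = D`. No measurability of `E` is required. -/
theorem sierpinskiHausdorff_image (hN : 2 ≤ N) (hD : 1 < D) (e : Fin D ≃o OneEntry A)
    (c : OneEntry A) (E : Set (sierpinskiSet A)) :
    sierpinskiHausdorff A (sierpinskiMap A c '' E) =
      (D : ℝ≥0∞)⁻¹ * sierpinskiHausdorff A E := by
  have hs := (similarityDim_pos hN hD).le
  have hN0 : 0 < N := by omega
  rw [sierpinskiHausdorff_eq e]
  refine le_antisymm ?_ ?_
  · refine ((lipschitzWith_sierpinskiMap c).hausdorffMeasure_image_le hs E).trans_eq ?_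
    rw [ENNReal.coe_inv (Nat.cast_ne_zero.2 hN0.ne'), ENNReal.coe_natCast, ENNReal.inv_rpow,
      natCast_rpow_similarityDim hN hD]
  · have h := (antilipschitzWith_sierpinskiMap hN0 c).le_hausdorffMeasure_image hs E
    rw [ENNReal.coe_natCast, natCast_rpow_similarityDim hN hD] at h
    rw [← ENNReal.div_eq_inv_mul]
    exact ENNReal.div_le_of_le_mul' h

theorem tendsto_natCast_inv_pow {n : ℕ} (hn : 1 < n) :
    Tendsto (fun k : ℕ => (n : ℝ≥0∞)⁻¹ ^ k) atTop (𝓝 0) :=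
  ENNReal.tendsto_pow_atTop_nhds_zero_of_lt_one
    (ENNReal.inv_lt_one.2 (by exact_mod_cast hn))

/-- The `D ^ k` cylinders of length `k` have diameter at most `2 * N⁻¹ ^ k`, so their `s`-sums are
bounded by `2 ^ s`, uniformly in `k`. -/
theorem sierpinskiHausdorff_univ_ne_top (hN : 2 ≤ N) (hD : 1 < D) (e : Fin D ≃o OneEntry A) :
    sierpinskiHausdorff A univ ≠ ∞ := by
  have hN0 : 0 < N := by omega
  have hD0 : 0 < D := by omega
  have hs := (similarityDim_pos hN hD).le
  have hdiam : ∀ (k : ℕ) (w : Fin k → Fin D),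
      Metric.ediam (sierpinskiPoint e '' {ω | ∀ i : Fin k, ω i = w i}) ≤
        2 * (N : ℝ≥0∞)⁻¹ ^ k := by
    rintro k w
    refine Metric.ediam_le ?_
    rintro _ ⟨ω, hω, rfl⟩ _ ⟨ω', hω', rfl⟩
    have h := dist_sierpinskiPoint_le hN0 e k (ω := ω) (ω' := ω')
      fun i hi => (hω ⟨i, hi⟩).trans (hω' ⟨i, hi⟩).symm
    rw [edist_dist]
    refine (ENNReal.ofReal_le_ofReal h).trans_eq ?_
    rw [ENNReal.ofReal_mul zero_le_two, ENNReal.ofReal_pow (by positivity),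
      ENNReal.ofReal_inv_of_pos (Nat.cast_pos.2 hN0), ENNReal.ofReal_natCast]
    simp
  have hr : Tendsto (fun k : ℕ => 2 * (N : ℝ≥0∞)⁻¹ ^ k) atTop (𝓝 0) := by
    simpa using ENNReal.Tendsto.const_mul (tendsto_natCast_inv_pow (by omega : 1 < N))
      (Or.inr (ENNReal.ofNat_ne_top (n := 2)))
  have h := Measure.hausdorffMeasure_le_liminf_sum (Real.log D / Real.log N)
    (univ : Set (sierpinskiSet A)) _ hr
    (fun (k : ℕ) (w : Fin k → Fin D) => sierpinskiPoint e '' {ω | ∀ i : Fin k, ω i = w i})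
    (Eventually.of_forall hdiam) (Eventually.of_forall fun k p _ => by
      obtain ⟨ω, rfl⟩ := surjective_sierpinskiPoint e p
      exact mem_iUnion.2 ⟨fun i => ω i, mem_image_of_mem _ fun i => rfl⟩)
  have hsum : ∀ k : ℕ, ∑ w : Fin k → Fin D,
      Metric.ediam (sierpinskiPoint e '' {ω | ∀ i : Fin k, ω i = w i}) ^
        (Real.log D / Real.log N) ≤ 2 ^ (Real.log D / Real.log N) := by
    intro k
    refine (Finset.sum_le_sum fun w _ => ENNReal.rpow_le_rpow (hdiam k w) hs).trans_eq ?_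
    rw [Finset.sum_const, ENNReal.mul_rpow_of_nonneg _ _ hs, inv_pow_rpow_similarityDim hN hD,
      Finset.card_univ, Fintype.card_fun, Fintype.card_fin, Fintype.card_fin, nsmul_eq_mul,
      Nat.cast_pow, mul_left_comm, ← mul_pow,
      ENNReal.mul_inv_cancel (Nat.cast_ne_zero.2 hD0.ne') (ENNReal.natCast_ne_top D), one_pow,
      mul_one]
  rw [sierpinskiHausdorff_eq e]
  refine ne_top_of_le_ne_top (ENNReal.rpow_ne_top_of_nonneg hs (ENNReal.ofNat_ne_top (n := 2)))
    (h.trans ((liminf_le_liminf (Eventually.of_forall hsum)).trans_eq (liminf_const _)))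

/-- After scaling by `N ^ k` the two numbers are at most `1` apart and each exceeds its leading
integer by at most `1`, so the integers differ by at most `2`. Truncated subtraction at the lower
end is harmless. -/
theorem mem_Icc_leadingNum (hN : 0 < N) (x : Fin D → Fin N) (k : ℕ) {ω ω' : CantorGroup D}
    (h : |Real.ofDigits (fun i => x (ω i)) - Real.ofDigits (fun i => x (ω' i))| ≤
      (N : ℝ)⁻¹ ^ k) :
    leadingNum x k ω ∈ Finset.Icc (leadingNum x k ω' - 2) (leadingNum x k ω' + 2) := by
  have hNk : (0 : ℝ) < (N : ℝ) ^ k := pow_pos (Nat.cast_pos.2 hN) k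
  obtain ⟨h1, h2⟩ := leadingNum_le_and_le hN x k ω
  obtain ⟨h3, h4⟩ := leadingNum_le_and_le hN x k ω'
  have h5 : |(N : ℝ) ^ k * Real.ofDigits (fun i => x (ω i)) -
      (N : ℝ) ^ k * Real.ofDigits (fun i => x (ω' i))| ≤ 1 := by
    rw [← mul_sub, abs_mul, abs_of_pos hNk]
    calc _ ≤ (N : ℝ) ^ k * (N : ℝ)⁻¹ ^ k := by gcongr
      _ = 1 := by rw [inv_pow, mul_inv_cancel₀ hNk.ne']
  obtain ⟨h6, h7⟩ := abs_le.1 h5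
  have h8 : (leadingNum x k ω : ℝ) ≤ (leadingNum x k ω' + 2 : ℕ) := by push_cast; linarith
  have h9 : (leadingNum x k ω' : ℝ) ≤ (leadingNum x k ω + 2 : ℕ) := by push_cast; linarith
  rw [Nat.cast_le] at h8 h9
  rw [Finset.mem_Icc]
  omega

/-- A set of diameter at most `N⁻¹ ^ k` meets at most `5` values of the leading integer in each
coordinate, hence `25` pairs, each of mass at most `D⁻¹ ^ k`. -/
theorem cantorMeasure_preimage_le [NeZero D] (hN : 0 < N) (e : Fin D ≃o OneEntry A) (k : ℕ)
    {U : Set (sierpinskiSet A)} (hU : Metric.ediam U ≤ (N : ℝ≥0∞)⁻¹ ^ k) :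
    cantorMeasure D (sierpinskiPoint e ⁻¹' U) ≤ 25 * (D : ℝ≥0∞)⁻¹ ^ k := by
  rcases (sierpinskiPoint e ⁻¹' U).eq_empty_or_nonempty with h0 | ⟨ω', hω'⟩
  · rw [h0, measure_empty]
    exact zero_le
  let I : Finset (ℕ × ℕ) :=
    Finset.Icc (leadingNum (rowDigit e) k ω' - 2) (leadingNum (rowDigit e) k ω' + 2) ×ˢ
      Finset.Icc (leadingNum (colDigit e) k ω' - 2) (leadingNum (colDigit e) k ω' + 2)
  have hI : I.card ≤ 25 := by
    rw [Finset.card_product, Nat.card_Icc, Nat.card_Icc]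
    calc _ ≤ 5 * 5 := Nat.mul_le_mul (by omega) (by omega)
      _ = 25 := rfl
  have hsub : sierpinskiPoint e ⁻¹' U ⊆ ⋃ m ∈ I,
      {ω | leadingNum (rowDigit e) k ω = m.1 ∧ leadingNum (colDigit e) k ω = m.2} := by
    intro ω hω
    have hd : dist (sierpinskiPoint e ω) (sierpinskiPoint e ω') ≤ (N : ℝ)⁻¹ ^ k := by
      have h1 := (Metric.edist_le_ediam_of_mem (mem_preimage.1 hω) (mem_preimage.1 hω')).trans hU
      rw [edist_dist] at h1
      refine (ENNReal.ofReal_le_ofReal_iff (by positivity)).1 (h1.trans_eq ?_)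
      rw [ENNReal.ofReal_pow (by positivity), ENNReal.ofReal_inv_of_pos (Nat.cast_pos.2 hN),
        ENNReal.ofReal_natCast]
    have hcoord : ∀ i, |(sierpinskiPoint e ω).1 i - (sierpinskiPoint e ω').1 i| ≤
        (N : ℝ)⁻¹ ^ k := fun i => by
      refine le_trans ?_ hd
      rw [Subtype.dist_eq, dist_eq_norm, ← Real.norm_eq_abs]
      exact PiLp.norm_apply_le ((sierpinskiPoint e ω).1 - (sierpinskiPoint e ω').1) i
    simp only [sierpinskiPoint, nadicPoint_eq_ofDigits] at hcoord
    refine mem_iUnion₂.2 ⟨(leadingNum (rowDigit e) k ω, leadingNum (colDigit e) k ω), ?_, rfl, rfl⟩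
    exact Finset.mem_product.2 ⟨mem_Icc_leadingNum hN _ k (hcoord 0),
      mem_Icc_leadingNum hN _ k (hcoord 1)⟩
  calc cantorMeasure D (sierpinskiPoint e ⁻¹' U)
      ≤ ∑ m ∈ I, cantorMeasure D
          {ω | leadingNum (rowDigit e) k ω = m.1 ∧ leadingNum (colDigit e) k ω = m.2} :=
        (measure_mono hsub).trans (measure_biUnion_finset_le _ _)
    _ ≤ ∑ _m ∈ I, (D : ℝ≥0∞)⁻¹ ^ k := Finset.sum_le_sum fun m _ =>
        cantorMeasure_leadingNum_le hN (injective_rowDigit_colDigit e) k m.1 m.2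
    _ ≤ 25 * (D : ℝ≥0∞)⁻¹ ^ k := by
        rw [Finset.sum_const, nsmul_eq_mul]
        gcongr
        exact_mod_cast hI

theorem exists_pow_lt_le {r d : ℝ≥0∞} (hr : r < 1) (hd0 : d ≠ 0) (hd1 : d ≤ 1) :
    ∃ k : ℕ, r ^ (k + 1) < d ∧ d ≤ r ^ k := by
  classical
  have hex : ∃ k : ℕ, r ^ (k + 1) < d :=
    (((tendsto_add_atTop_iff_nat 1).2
      (ENNReal.tendsto_pow_atTop_nhds_zero_of_lt_one hr)).eventually_lt_const
        (pos_iff_ne_zero.2 hd0)).exists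
  refine ⟨Nat.find hex, Nat.find_spec hex, ?_⟩
  cases hk : Nat.find hex with
  | zero => simpa using hd1
  | succ k => exact not_lt.1 (Nat.find_min hex (hk ▸ Nat.lt_succ_self k))

theorem map_sierpinskiPoint_le [NeZero D] (hN : 2 ≤ N) (hD : 1 < D) (e : Fin D ≃o OneEntry A)
    {U : Set (sierpinskiSet A)} (hU : Metric.ediam U ≤ 1) :
    (cantorMeasure D).map (sierpinskiPoint e) U ≤
      25 * D * Metric.ediam U ^ (Real.log D / Real.log N) := by
  have hN0 : 0 < N := by omega
  have hs := similarityDim_pos hN hD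
  have hle : ∀ k, Metric.ediam U ≤ (N : ℝ≥0∞)⁻¹ ^ k →
      (cantorMeasure D).map (sierpinskiPoint e) U ≤ 25 * (D : ℝ≥0∞)⁻¹ ^ k := fun k hk => by
    -- `U` is arbitrary; its closure is measurable and has the same diameter.
    refine (measure_mono subset_closure).trans ?_
    rw [Measure.map_apply (continuous_sierpinskiPoint e).measurable isClosed_closure.measurableSet]
    exact cantorMeasure_preimage_le hN0 e k (by rwa [Metric.ediam_closure])
  -- A set of diameter zero has no scale of its own; the bound at every `k` forces its mass to
  -- vanish.
  by_cases hd0 : Metric.ediam U = 0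
  · have hlim : Tendsto (fun k : ℕ => 25 * (D : ℝ≥0∞)⁻¹ ^ k) atTop (𝓝 0) := by
      simpa using ENNReal.Tendsto.const_mul (tendsto_natCast_inv_pow hD)
        (Or.inr (ENNReal.ofNat_ne_top (n := 25)))
    refine le_trans (ge_of_tendsto' hlim fun k => hle k ?_) zero_le
    rw [hd0]
    exact zero_le
  · obtain ⟨k, hk1, hk2⟩ := exists_pow_lt_le
      (ENNReal.inv_lt_one.2 (by exact_mod_cast hN : (1 : ℝ≥0∞) < N)) hd0 hU
    calc _ ≤ 25 * (D : ℝ≥0∞)⁻¹ ^ k := hle k hk2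
      -- The extra factor `D` pays for passing to level `k + 1`, where `N⁻¹ ^ (k + 1)` lies below
      -- the diameter.
      _ = 25 * D * (D : ℝ≥0∞)⁻¹ ^ (k + 1) := by
        rw [pow_succ', mul_assoc, ← mul_assoc (D : ℝ≥0∞), mul_comm (D : ℝ≥0∞),
          natCast_inv_mul_cancel, one_mul]
      _ ≤ _ := by
        rw [← inv_pow_rpow_similarityDim hN hD]
        gcongr

/-- Mass distribution principle: the image of `ν_D` divided by `25 * D` is at most the `s`-th power
of the diameter on sets of diameter at most `1`. It is therefore dominated by Hausdorff measure, and
its total mass is positive. -/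
theorem sierpinskiHausdorff_univ_ne_zero (hN : 2 ≤ N) (hD : 1 < D) (e : Fin D ≃o OneEntry A) :
    sierpinskiHausdorff A univ ≠ 0 := by
  have : NeZero D := ⟨by omega⟩
  have hC0 : (25 * D : ℝ≥0∞) ≠ 0 := by simp [NeZero.ne D]
  have hC1 : (25 * D : ℝ≥0∞) ≠ ∞ :=
    ENNReal.mul_ne_top ENNReal.ofNat_ne_top (ENNReal.natCast_ne_top D)
  have h := Measure.le_hausdorffMeasure (Real.log D / Real.log N)
    ((25 * D : ℝ≥0∞)⁻¹ • (cantorMeasure D).map (sierpinskiPoint e)) 1 one_pos fun U hU => by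
      rw [Measure.smul_apply, smul_eq_mul, ← ENNReal.div_eq_inv_mul]
      exact ENNReal.div_le_of_le_mul' (map_sierpinskiPoint_le hN hD e hU)
  have h1 := h univ
  rw [Measure.smul_apply, Measure.map_apply (continuous_sierpinskiPoint e).measurable
    MeasurableSet.univ, preimage_univ, measure_univ, smul_eq_mul, mul_one,
    ← sierpinskiHausdorff_eq e] at h1
  intro h0
  rw [h0, nonpos_iff_eq_zero, ENNReal.inv_eq_zero] at h1
  exact hC1 h1

theorem isProbabilityMeasure_sierpinskiMeasure (hN : 2 ≤ N) (hD : 1 < D)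
    (e : Fin D ≃o OneEntry A) : IsProbabilityMeasure (sierpinskiMeasure A) := by
  refine ⟨?_⟩
  rw [sierpinskiMeasure, Measure.smul_apply, smul_eq_mul]
  exact ENNReal.inv_mul_cancel (sierpinskiHausdorff_univ_ne_zero hN hD e)
    (sierpinskiHausdorff_univ_ne_top hN hD e)

theorem isDigitCoding_sierpinskiPoint (hN : 2 ≤ N) (hD : 1 < D) (e : Fin D ≃o OneEntry A) :
    IsDigitCoding (sierpinskiMeasure A) (fun j => sierpinskiMap A (e j)) (sierpinskiPoint e) where
  continuous_map j := (lipschitzWith_sierpinskiMap (e j)).continuous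
  injective_map j := (antilipschitzWith_sierpinskiMap (by omega) (e j)).injective
  continuous := continuous_sierpinskiPoint e
  surjective := surjective_sierpinskiPoint e
  apply_prependDigit := sierpinskiPoint_prependDigit e
  measure_image j E := by
    rw [sierpinskiMeasure, Measure.smul_apply, Measure.smul_apply,
      sierpinskiHausdorff_image hN hD e, smul_eq_mul, smul_eq_mul, mul_left_comm]

end SierpinskiMeasure

/-- The representation of the Cuntz algebra `𝒪_D` on `L²(𝕊_A, H)` given by the semibranching function
system `(τ_j)` is unitarily equivalent to the monic representation of `𝒪_D` on `L²(K_D, ν_D)`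
corresponding to the standard positive monic system. The order isomorphism `e` lists the positions
of the ones of `A` in lexicographic order; in particular `A` has exactly `D` ones. -/
theorem mainTheorem3 (N D : ℕ) (hN : 2 ≤ N) (hD : 1 < D)
    (A : Matrix (Fin N) (Fin N) ℕ) (hA : ∀ a b, A a b = 0 ∨ A a b = 1)
    (e : Fin D ≃o OneEntry A)
    (τ : sierpinskiSet A → sierpinskiSet A) (hτ : IsSierpinskiCoding A τ) :
    IsProbabilityMeasure (sierpinskiMeasure A) ∧
    IsSemibranchingSystem (sierpinskiMeasure A) (fun j => sierpinskiMap A (e j)) τ ∧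
    IsNonnegMonicSystem (cantorMeasure D) (standardMonicFun D) ∧
    (∃! π : CuntzAlgebra D →⋆ₐ[ℂ]
        (Lp ℂ 2 (sierpinskiMeasure A) →L[ℂ] Lp ℂ 2 (sierpinskiMeasure A)),
      IsSemibranchingRep (sierpinskiMeasure A) (fun j => sierpinskiMap A (e j)) τ π) ∧
    (∃! ρ : CuntzAlgebra D →⋆ₐ[ℂ] (Lp ℂ 2 (cantorMeasure D) →L[ℂ] Lp ℂ 2 (cantorMeasure D)),
      IsMonicRep (cantorMeasure D) (standardMonicFun D) ρ) ∧
    ∀ (π : CuntzAlgebra D →⋆ₐ[ℂ]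
        (Lp ℂ 2 (sierpinskiMeasure A) →L[ℂ] Lp ℂ 2 (sierpinskiMeasure A)))
      (ρ : CuntzAlgebra D →⋆ₐ[ℂ] (Lp ℂ 2 (cantorMeasure D) →L[ℂ] Lp ℂ 2 (cantorMeasure D))),
      IsSemibranchingRep (sierpinskiMeasure A) (fun j => sierpinskiMap A (e j)) τ π →
      IsMonicRep (cantorMeasure D) (standardMonicFun D) ρ →
      UnitarilyEquivalent π ρ := by
  have : NeZero D := ⟨by omega⟩
  have := compactSpace_sierpinskiSet e
  have := isProbabilityMeasure_sierpinskiMeasure hN hD e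
  have h := isDigitCoding_sierpinskiPoint hN hD e
  have hτ' := exists_sierpinskiPoint_of_coding (by omega) e hτ
  obtain ⟨π₀, hπ₀⟩ := h.exists_isSemibranchingRep hτ'
  obtain ⟨ρ₀, hρ₀⟩ := exists_isMonicRep_standard (D := D)
  exact ⟨inferInstance, h.isSemibranchingSystem hτ', isNonnegMonicSystem_standard,
    ⟨π₀, hπ₀, fun _ hπ => hπ.ext hπ₀⟩, ⟨ρ₀, hρ₀, fun _ hρ => hρ.ext hρ₀⟩,
    fun _ _ hπ hρ => h.unitarilyEquivalent hτ' hπ hρ⟩
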